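/- \textbf{Setting.} Let $M$ be a complex manifold, $TM$ its holomorphic tangent bundle, and $H$ the associated $C^\infty$ bundle, with $(0,1)$-operator $d''$. A \emph{harmonic Frobenius manifold} structure on $M$ consists of the following data on $TM$. (1) A Saito structure of weight $0$: a holomorphic connection $\nabla$, a holomorphic $\mathrm{End}(TM)$-valued one-form $\Phi$, a nondegenerate symmetric holomorphic bilinear form $g$, and holomorphic endomorphisms $\mathcal U,\mathcal V$, with $\nabla^2=0$, $\nabla(\mathcal V)=0$, $\Phi\wedge\Phi=0$, $[\mathcal U,\Phi]=0$, $\nabla(\Phi)=0$, $\nabla(\mathcal U)-[\Phi,\mathcal V]+\Phi=0$, $\nabla(g)=0$, $\mathcal V^*+\mathcal V=0$, $\Phi^*=\Phi$, $\mathcal U^*=\mathcal U$, where $^*$ is the $g$-adjoint. (2) The Frobenius conditions: $\nabla$ is torsion free, $\Phi_\xi\eta=\Phi_\eta\xi$, and there is a holomorphic vector field $e$ with $\nabla e=0$, $\Phi_e=-\mathrm{id}$ and $\mathcal V e=ce$, where $c\in\mathbb R$. Put $\xi\circ\eta=-\Phi_\xi\eta$ and $E=\mathcal U(e)$ (the Euler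 field). (3) A $C^\infty$ antilinear endomorphism $\kappa$ of $H$ with $\kappa^2=\mathrm{id}$, such that $g$ is real on $\ker(\kappa-\mathrm{id})$, and a $C^\infty$ endomorphism $A^\dagger$ of $H$ with $(A^\dagger)^*=A^\dagger$. Put $h(a,b)=g(a,\kappa b)$, $D'=\nabla-[A^\dagger,\Phi]$, $D=D'+d''$, $\Phi^\dagger=d''A^\dagger$ and $\mathcal Q=\mathcal V+[A^\dagger,\mathcal U]$. It is required that $D$ is the Chern connection of $h$, $D'(g)=0$, $\Phi^\dagger$ is the $h$-adjoint of $\Phi$, $\mathcal Q$ is $h$-selfadjoint, and $D+\Phi+\Phi^\dagger$ is integrable (that is, $(TM,h,\Phi)$ is a harmonic Higgs bundle). \textbf{Proposition.} Every harmonic Frobenius manifold is a manifold with a CDV-structure. Explicitly, with $d=2c\in\mathbb R$: (a) $(M,\circ,e,E,g)$ is a Frobenius manifold of charge $d$: $\circ$ is a holomorphic, commutative, associative multiplication on $TM$ with unit field $e$, $g(X\circ Y,Z)=g(X,Y\circ Z)$, the Levi-Civita connection of $g$ is $\nabla$ and is flat, $\nabla e=0$, $(\nabla_X\circ)(Y,Z)$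 is symmetric in $X,Y,Z$, $\mathrm{Lie}_E(\circ)=\circ$ and $\mathrm{Lie}_E(g)=(2-d)g$. (b) $\kappa$ is a real structure, $h=g(\cdot,\kappa\,\cdot)$ is a nondegenerate Hermitian form with $h(\kappa a,\kappa b)=\overline{h(a,b)}$, and its ($C^\infty$) Chern connection $D=D'+d''$ satisfies $D(g)=0$ and $D(\kappa)=0$. (c) Let $C_XY=-X\circ Y$. Then $\kappa C\kappa$ is the $h$-adjoint of $C$, and $D+C+\kappa C\kappa$ is integrable. (d) $\mathrm{Lie}_e(h)=0$ and $\mathrm{Lie}_{E-\overline E}(h)=0$. (e) $\mathcal Q=D_E-\mathrm{Lie}_E-\frac{2-d}{2}\,\mathrm{id}=D_E-\mathrm{Lie}_E-(1-c)\,\mathrm{id}$; moreover, $\mathcal Q$ is a $C^\infty$ endomorphism of $H$, $h$-selfadjoint, and $\mathcal Q\kappa=-\kappa\mathcal Q$. (f) (Integrability.) With $\mathcal U=E\circ$ and $\mathcal U^\dagger=\kappa\,\mathcal U\kappa$, the endomorphism $\mathcal U$ is holomorphic, and $[C,\mathcal U]=0$, $D'(\mathcal U)-[C,\mathcal Q]+C=0$,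 $D'(\mathcal Q)+[C,\mathcal U^\dagger]=0$, $D'(\mathcal U^\dagger)=0$, $[\kappa C\kappa,\mathcal U^\dagger]=0$, $d''(\mathcal U^\dagger)+[\kappa C\kappa,\mathcal Q]+\kappa C\kappa=0$, $d''(\mathcal Q)=[\kappa C\kappa,\mathcal U]$. -/

import Mathlib

open scoped Manifold ContDiff

noncomputable section

namespace HarmonicFrobenius

/-! The model space is a finite-dimensional complex vector space `E`, the complex manifold is `M`.
The holomorphic tangent bundle `TM` has fibres `TangentSpace 𝓘(ℂ, E) x`; the tangent vector `v` is
identified with the vector `v - i J v` (up to the factor `1/2`) of type `(1,0)`, so that the `C^∞`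
bundle `H` associated with `TM` is `TM` itself, with its real-smooth sections. -/

section Calculus

/-- The holomorphic tangent space at `x`. -/
abbrev Tan (E : Type*) [NormedAddCommGroup E] [NormedSpace ℂ E] {M : Type*}
    [TopologicalSpace M] [ChartedSpace E M] (x : M) : Type _ :=
  TangentSpace 𝓘(ℂ, E) x

/-- (Not necessarily continuous) vector fields; all regularity is imposed on open sets. -/
abbrev Field (E : Type*) [NormedAddCommGroup E] [NormedSpace ℂ E] (M : Type*)
    [TopologicalSpace M] [ChartedSpace E M] : Type _ :=
  (x : M) → Tan E x

/-- Families of complex-linear endomorphisms of the tangent spaces. -/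
abbrev EndField (E : Type*) [NormedAddCommGroup E] [NormedSpace ℂ E] (M : Type*)
    [TopologicalSpace M] [ChartedSpace E M] : Type _ :=
  (x : M) → Module.End ℂ (Tan E x)

/-- `End(TM)`-valued forms of type `(1,0)`. -/
abbrev EndForm (E : Type*) [NormedAddCommGroup E] [NormedSpace ℂ E] (M : Type*)
    [TopologicalSpace M] [ChartedSpace E M] : Type _ :=
  (x : M) → Tan E x →ₗ[ℂ] Module.End ℂ (Tan E x)

/-- `End(TM)`-valued forms of type `(0,1)`, evaluated on the conjugate of a tangent vector.
(Antilinearity is a consequence of the equations imposed on such forms below.) -/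
abbrev EndAntiForm (E : Type*) [NormedAddCommGroup E] [NormedSpace ℂ E] (M : Type*)
    [TopologicalSpace M] [ChartedSpace E M] : Type _ :=
  (x : M) → Tan E x → Module.End ℂ (Tan E x)

/-- Families of complex bilinear forms on the tangent spaces. -/
abbrev BilinField (E : Type*) [NormedAddCommGroup E] [NormedSpace ℂ E] (M : Type*)
    [TopologicalSpace M] [ChartedSpace E M] : Type _ :=
  (x : M) → Tan E x →ₗ[ℂ] Tan E x →ₗ[ℂ] ℂ

/-- Families of antilinear endomorphisms of the tangent spaces. -/
abbrev AntiEndField (E : Type*) [NormedAddCommGroup E] [NormedSpace ℂ E] (M : Type*)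
    [TopologicalSpace M] [ChartedSpace E M] : Type _ :=
  (x : M) → Tan E x →ₛₗ[starRingEnd ℂ] Tan E x

variable {E : Type*} [NormedAddCommGroup E] [NormedSpace ℂ E]
  {M : Type*} [TopologicalSpace M] [ChartedSpace E M]

/-- `∂_v f = (df(v) - i df(iv)) / 2`, the derivative of `f` along the `(1,0)` vector of `v`. -/
def del {F : Type*} [NormedAddCommGroup F] [NormedSpace ℂ F] (f : M → F) (x : M) (v : Tan E x) :
    F :=
  let df : E → F := fun w => mfderiv 𝓘(ℝ, E) 𝓘(ℝ, F) f x w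
  let v' : E := v
  (1 / 2 : ℂ) • (df v' - Complex.I • df (Complex.I • v'))

/-- `∂̄_v f = (df(v) + i df(iv)) / 2`, the derivative of `f` along the `(0,1)` vector conjugate
to that of `v`. -/
def delbar {F : Type*} [NormedAddCommGroup F] [NormedSpace ℂ F] (f : M → F) (x : M)
    (v : Tan E x) : F :=
  let df : E → F := fun w => mfderiv 𝓘(ℝ, E) 𝓘(ℝ, F) f x w
  let v' : E := v
  (1 / 2 : ℂ) • (df v' + Complex.I • df (Complex.I • v'))

/-- Holomorphic functions on an open set. -/
def IsHolFunOn (f : M → ℂ) (W : Set M) : Prop :=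
  MDifferentiableOn 𝓘(ℂ, E) 𝓘(ℂ) f W

/-- Complex-valued `C^∞` functions on an open set. -/
def IsSmoothFunOn (f : M → ℂ) (W : Set M) : Prop :=
  ContMDiffOn 𝓘(ℝ, E) 𝓘(ℝ, ℂ) ∞ f W

variable [IsManifold 𝓘(ℂ, E) ω M]

/-- The vector field `X` in the coordinates given by the preferred chart at `x`. -/
def coord (X : Field E M) (x : M) : M → E := fun y =>
  (trivializationAt E (TangentSpace 𝓘(ℂ, E) : M → Type _) x
    (⟨y, X y⟩ : TangentBundle 𝓘(ℂ, E) M)).2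

/-- Holomorphic vector fields on an open set. -/
def IsHolOn (X : Field E M) (W : Set M) : Prop :=
  MDifferentiableOn 𝓘(ℂ, E) 𝓘(ℂ, E).tangent
    (fun y => (⟨y, X y⟩ : TangentBundle 𝓘(ℂ, E) M)) W

/-- `C^∞` sections of `H` on an open set. -/
def IsSmoothOn (X : Field E M) (W : Set M) : Prop :=
  ∀ x ∈ W, ContMDiffAt 𝓘(ℝ, E) 𝓘(ℝ, E) ∞ (coord X x) x

/-- `d''_v̄ X`, the canonical `(0,1)`-operator of the holomorphic bundle `TM` on sections of `H`. -/
def dbar (X : Field E M) (x : M) (v : Tan E x) : Tan E x :=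
  (trivializationAt E (TangentSpace 𝓘(ℂ, E) : M → Type _) x).symm x (delbar (coord X x) x v)

/-- The Lie bracket of holomorphic vector fields. -/
abbrev bracket (X Y : Field E M) : Field E M :=
  VectorField.mlieBracket 𝓘(ℂ, E) X Y

/-- Holomorphic families of endomorphisms: `d''(P) = 0`. -/
def IsHolEnd (P : EndField E M) : Prop :=
  ∀ (W : Set M) (X : Field E M), IsOpen W → IsHolOn X W → IsHolOn (fun x => P x (X x)) W

/-- `C^∞` families of endomorphisms. -/
def IsSmoothEnd (P : EndField E M) : Prop :=
  ∀ (W : Set M) (X : Field E M), IsOpen W → IsSmoothOn X W → IsSmoothOn (fun x => P x (X x)) W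

/-- `C^∞` families of antilinear endomorphisms. -/
def IsSmoothAntiEnd (κ : AntiEndField E M) : Prop :=
  ∀ (W : Set M) (X : Field E M), IsOpen W → IsSmoothOn X W → IsSmoothOn (fun x => κ x (X x)) W

/-- Holomorphic `End(TM)`-valued one-forms: `d''(Φ) = 0`. -/
def IsHolForm (Φ : EndForm E M) : Prop :=
  ∀ (W : Set M) (X Y : Field E M), IsOpen W → IsHolOn X W → IsHolOn Y W →
    IsHolOn (fun x => Φ x (X x) (Y x)) W

/-- Holomorphic bilinear forms. -/
def IsHolBilin (g : BilinField E M) : Prop :=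
  ∀ (W : Set M) (X Y : Field E M), IsOpen W → IsHolOn X W → IsHolOn Y W →
    IsHolFunOn (E := E) (fun x => g x (X x) (Y x)) W

end Calculus

section Connections

variable {E : Type*} [NormedAddCommGroup E] [NormedSpace ℂ E]
  {M : Type*} [TopologicalSpace M] [ChartedSpace E M] [IsManifold 𝓘(ℂ, E) ω M]

variable (E M) in
/-- A connection of type `(1,0)` on `H`, that is, the `(1,0)`-part `D'` of a connection
`D = D' + d''` on `H`. Caution: `D X x v` is `D'_v X` at `x`. -/
structure Connection10 where
  toFun : Field E M → (x : M) → Tan E x →ₗ[ℂ] Tan E x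
  add : ∀ (W : Set M) (X Y : Field E M), IsOpen W → IsSmoothOn X W → IsSmoothOn Y W →
    ∀ x ∈ W, toFun (fun y => X y + Y y) x = toFun X x + toFun Y x
  leibniz : ∀ (W : Set M) (f : M → ℂ) (X : Field E M), IsOpen W → IsSmoothFunOn (E := E) f W →
    IsSmoothOn X W → ∀ x ∈ W, ∀ v : Tan E x,
      toFun (fun y => f y • X y) x v = f x • toFun X x v + del f x v • X x

instance : CoeFun (Connection10 E M) (fun _ => Field E M → (x : M) → Tan E x →ₗ[ℂ] Tan E x) :=
  ⟨Connection10.toFun⟩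

namespace Connection10

/-- The connection `D` plus a one-form with values in endomorphisms. -/
def addForm (D : Connection10 E M) (S : EndForm E M) : Connection10 E M where
  toFun X x := D X x + (S x).flip (X x)
  add W X Y hW hX hY x hx := by
    rw [D.add W X Y hW hX hY x hx, map_add]; abel
  leibniz W f X hW hf hX x hx v := by
    simp only [LinearMap.add_apply, D.leibniz W f X hW hf hX x hx v, map_smul,
      LinearMap.smul_apply, smul_add]
    abel

/-- `D_X Y` is `C^∞` if `X` and `Y` are so. -/
def IsSmooth (D : Connection10 E M) : Prop :=
  ∀ (W : Set M) (X Y : Field E M), IsOpen W → IsSmoothOn X W → IsSmoothOn Y W →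
    IsSmoothOn (fun x => D Y x (X x)) W

/-- Holomorphic connections: `d'' D + D d'' = 0`. -/
def IsHol (D : Connection10 E M) : Prop :=
  ∀ (W : Set M) (X Y : Field E M), IsOpen W → IsHolOn X W → IsHolOn Y W →
    IsHolOn (fun x => D Y x (X x)) W

/-- `D² = 0` for the operator `D` of type `(1,0)`: its curvature tensor of type `(2,0)` vanishes
(holomorphic vector fields span all tangent spaces). -/
def IsFlat (D : Connection10 E M) : Prop :=
  ∀ (W : Set M) (X Y Z : Field E M), IsOpen W → IsHolOn X W → IsHolOn Y W → IsHolOn Z W →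
    ∀ x ∈ W, D (fun y => D Z y (Y y)) x (X x) - D (fun y => D Z y (X y)) x (Y x)
      - D Z x (bracket X Y x) = 0

/-- `D_X Y - D_Y X = [X, Y]`. -/
def IsTorsionFree (D : Connection10 E M) : Prop :=
  ∀ (W : Set M) (X Y : Field E M), IsOpen W → IsHolOn X W → IsHolOn Y W →
    ∀ x ∈ W, D Y x (X x) - D X x (Y x) = bracket X Y x

/-- The derivative `D_v(P)` of an endomorphism, applied to the vector field `Z`:
`[D_v, P] Z`. -/
def covEnd (D : Connection10 E M) (P : EndField E M) (Z : Field E M) (x : M) (v : Tan E x) :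
    Tan E x :=
  D (fun y => P y (Z y)) x v - P x (D Z x v)

/-- `D(Φ) = 0` for an `End(TM)`-valued `(1,0)`-form `Φ`:
`[D_X, Φ_Y] - [D_Y, Φ_X] - Φ_[X,Y] = 0`. -/
def KillsForm (D : Connection10 E M) (Φ : EndForm E M) : Prop :=
  ∀ (W : Set M) (X Y Z : Field E M), IsOpen W → IsHolOn X W → IsHolOn Y W → IsHolOn Z W →
    ∀ x ∈ W, D.covEnd (fun y => Φ y (Y y)) Z x (X x) - D.covEnd (fun y => Φ y (X y)) Z x (Y x)
      - Φ x (bracket X Y x) (Z x) = 0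

/-- `D(Ψ) = 0` for an `End(TM)`-valued `(0,1)`-form `Ψ`: as `[X, Ȳ] = 0` for holomorphic `X`
and `Y`, this means `[D_X, Ψ_Ȳ] = 0`. -/
def KillsAntiForm (D : Connection10 E M) (Ψ : EndAntiForm E M) : Prop :=
  ∀ (W : Set M) (X Y Z : Field E M), IsOpen W → IsHolOn X W → IsHolOn Y W → IsHolOn Z W →
    ∀ x ∈ W, D.covEnd (fun y => Ψ y (Y y)) Z x (X x) = 0

/-- `D(g) = 0` on `C^∞` sections. -/
def KillsBilin (D : Connection10 E M) (g : BilinField E M) : Prop :=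
  ∀ (W : Set M) (Y Z : Field E M), IsOpen W → IsSmoothOn Y W → IsSmoothOn Z W →
    ∀ x ∈ W, ∀ v : Tan E x,
      del (fun y => g y (Y y) (Z y)) x v = g x (D Y x v) (Z x) + g x (Y x) (D Z x v)

/-- `∇(g) = 0` on holomorphic sections. -/
def KillsBilinHol (D : Connection10 E M) (g : BilinField E M) : Prop :=
  ∀ (W : Set M) (Y Z : Field E M), IsOpen W → IsHolOn Y W → IsHolOn Z W →
    ∀ x ∈ W, ∀ v : Tan E x,
      del (fun y => g y (Y y) (Z y)) x v = g x (D Y x v) (Z x) + g x (Y x) (D Z x v)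

/-- `D = D' + d''` is the Chern connection of the sesquilinear form `h`. -/
def IsChern (D : Connection10 E M) (h : (x : M) → Tan E x → Tan E x → ℂ) : Prop :=
  ∀ (W : Set M) (Y Z : Field E M), IsOpen W → IsSmoothOn Y W → IsSmoothOn Z W →
    ∀ x ∈ W, ∀ v : Tan E x,
      del (fun y => h y (Y y) (Z y)) x v = h x (D Y x v) (Z x) + h x (Y x) (dbar Z x v)

/-- `D(κ) = 0`, that is, `D' κ = κ d''`, and equivalently `κ D' = d'' κ`. -/
def KillsReal (D : Connection10 E M) (κ : AntiEndField E M) : Prop :=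
  ∀ (W : Set M) (Y : Field E M), IsOpen W → IsSmoothOn Y W → ∀ x ∈ W, ∀ v : Tan E x,
    D (fun y => κ y (Y y)) x v = κ x (dbar Y x v) ∧
    dbar (fun y => κ y (Y y)) x v = κ x (D Y x v)

end Connection10

/-- The sesquilinear form `h(a, b) = g(a, κ b)`, equivalently `h(a, κ b) = g(a, b)` if `κ² = 1`. -/
def herm (g : BilinField E M) (κ : AntiEndField E M) (x : M) (a b : Tan E x) : ℂ :=
  g x a (κ x b)

/-- `κ P κ`. -/
def conjEnd (κ : AntiEndField E M) (x : M) (P : Module.End ℂ (Tan E x)) :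
    Module.End ℂ (Tan E x) :=
  (κ x).comp (P.comp (κ x))

/-- `d''(Ψ) = 0` for an `End(TM)`-valued `(0,1)`-form `Ψ`. -/
def DbarKillsAntiForm (Ψ : EndAntiForm E M) : Prop :=
  ∀ (W : Set M) (X Y Z : Field E M), IsOpen W → IsHolOn X W → IsHolOn Y W → IsHolOn Z W →
    ∀ x ∈ W, dbar (fun y => Ψ y (Y y) (Z y)) x (X x) - dbar (fun y => Ψ y (X y) (Z y)) x (Y x)
      - Ψ x (bracket X Y x) (Z x) = 0

/-- The relations expressing that `D' + d'' + Φ + Φ†` is an integrable connection, for a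
connection `D = D' + d''`, a Higgs field `Φ` and a `(0,1)`-form `Φ†`. -/
structure IsHarmonicHiggs (D : Connection10 E M) (Φ : EndForm E M) (Φd : EndAntiForm E M) :
    Prop where
  phi_hol : IsHolForm Φ
  phi_wedge : ∀ (x : M) (v w : Tan E x), ⁅Φ x v, Φ x w⁆ = 0
  d_sq : D.IsFlat
  d_phiDag : D.KillsAntiForm Φd
  phiDag_wedge : ∀ (x : M) (v w : Tan E x), ⁅Φd x v, Φd x w⁆ = 0
  d_phi : D.KillsForm Φ
  dbar_phiDag : DbarKillsAntiForm Φd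
  /-- `D' d'' + d'' D' = -(Φ ∧ Φ† + Φ† ∧ Φ)`, evaluated on `(X, w̄)` and applied to `Z`,
  for `X` and `Z` holomorphic. -/
  curvature : ∀ (W : Set M) (X Z : Field E M), IsOpen W → IsHolOn X W → IsHolOn Z W →
    ∀ x ∈ W, ∀ w : Tan E x,
      dbar (fun y => D Z y (X y)) x w = ⁅Φ x (X x), Φd x w⁆ (Z x)

/-- Integrability: the connection
`D + Φ / z + z Φ† + (U / z - Q - z U†) dz / z` on the pull-back of `H` to `ℂˣ × M`,
where `D + Φ / z + z Φ†` is already integrable relatively to `z`, is integrable.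
The equations are the coefficients of the powers of `z` in the remaining part of the curvature. -/
structure IsIntegrable (D : Connection10 E M) (Φ : EndForm E M) (Φd : EndAntiForm E M)
    (U Ud Q : EndField E M) : Prop where
  u_hol : IsHolEnd U
  phi_u : ∀ (x : M) (v : Tan E x), ⁅Φ x v, U x⁆ = 0
  d_u : ∀ (W : Set M) (Z : Field E M), IsOpen W → IsHolOn Z W → ∀ x ∈ W, ∀ v : Tan E x,
    D.covEnd U Z x v - ⁅Φ x v, Q x⁆ (Z x) + Φ x v (Z x) = 0
  d_q : ∀ (W : Set M) (Z : Field E M), IsOpen W → IsHolOn Z W → ∀ x ∈ W, ∀ v : Tan E x,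
    D.covEnd Q Z x v + ⁅Φ x v, Ud x⁆ (Z x) = 0
  d_uDag : ∀ (W : Set M) (Z : Field E M), IsOpen W → IsHolOn Z W → ∀ x ∈ W, ∀ v : Tan E x,
    D.covEnd Ud Z x v = 0
  phiDag_uDag : ∀ (x : M) (v : Tan E x), ⁅Φd x v, Ud x⁆ = 0
  dbar_uDag : ∀ (W : Set M) (Z : Field E M), IsOpen W → IsHolOn Z W → ∀ x ∈ W, ∀ v : Tan E x,
    dbar (fun y => Ud y (Z y)) x v + ⁅Φd x v, Q x⁆ (Z x) + Φd x v (Z x) = 0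
  dbar_q : ∀ (W : Set M) (Z : Field E M), IsOpen W → IsHolOn Z W → ∀ x ∈ W, ∀ v : Tan E x,
    dbar (fun y => Q y (Z y)) x v - ⁅Φd x v, U x⁆ (Z x) = 0

/-- `Lie_A(h) = 0` for a holomorphic vector field `A` (of type `(1,0)`) and a sesquilinear form
`h`; recall that `[A, Ȳ] = 0` for `Y` holomorphic. -/
def LieKills (A : Field E M) (h : (x : M) → Tan E x → Tan E x → ℂ) : Prop :=
  ∀ (W : Set M) (X Y : Field E M), IsOpen W → IsHolOn X W → IsHolOn Y W → ∀ x ∈ W,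
    del (fun y => h y (X y) (Y y)) x (A x) - h x (bracket A X x) (Y x) = 0

/-- `Lie_{A - Ā}(h) = 0` for a holomorphic vector field `A` (of type `(1,0)`) and a sesquilinear
form `h`. -/
def LieSubConjKills (A : Field E M) (h : (x : M) → Tan E x → Tan E x → ℂ) : Prop :=
  ∀ (W : Set M) (X Y : Field E M), IsOpen W → IsHolOn X W → IsHolOn Y W → ∀ x ∈ W,
    (del (fun y => h y (X y) (Y y)) x (A x) - h x (bracket A X x) (Y x))
      - (delbar (fun y => h y (X y) (Y y)) x (A x) - h x (X x) (bracket A Y x)) = 0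

/-- `Q = D_A - Lie_A - r · id`, as endomorphisms of `TM`, for a holomorphic vector field `A`.
(Both sides are tensors, so that it suffices to apply them to holomorphic vector fields, for
which `D_A = D'_A`.) -/
def EqCovSubLie (Q : EndField E M) (D : Connection10 E M) (A : Field E M) (r : ℂ) : Prop :=
  ∀ (W : Set M) (X : Field E M), IsOpen W → IsHolOn X W → ∀ x ∈ W,
    Q x (X x) = D X x (A x) - bracket A X x - r • X x

end Connections

section Structures

variable {E : Type*} [NormedAddCommGroup E] [NormedSpace ℂ E]
  {M : Type*} [TopologicalSpace M] [ChartedSpace E M] [IsManifold 𝓘(ℂ, E) ω M]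

variable (E M) in
/-- A Saito structure (of weight `0`) on the tangent bundle of `M`. -/
structure SaitoStructure where
  nabla : Connection10 E M
  g : BilinField E M
  Phi : EndForm E M
  U : EndField E M
  V : EndField E M
  nabla_hol : nabla.IsHol
  g_hol : IsHolBilin g
  g_symm : ∀ (x : M) (a b : Tan E x), g x a b = g x b a
  g_nondeg : ∀ (x : M) (a : Tan E x), (∀ b, g x a b = 0) → a = 0
  phi_hol : IsHolForm Phi
  u_hol : IsHolEnd U
  v_hol : IsHolEnd V
  nabla_sq : nabla.IsFlat
  nabla_v : ∀ (W : Set M) (Z : Field E M), IsOpen W → IsHolOn Z W → ∀ x ∈ W, ∀ v : Tan E x,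
    nabla.covEnd V Z x v = 0
  phi_wedge : ∀ (x : M) (v w : Tan E x), ⁅Phi x v, Phi x w⁆ = 0
  u_phi : ∀ (x : M) (v : Tan E x), ⁅U x, Phi x v⁆ = 0
  nabla_phi : nabla.KillsForm Phi
  nabla_u : ∀ (W : Set M) (Z : Field E M), IsOpen W → IsHolOn Z W → ∀ x ∈ W, ∀ v : Tan E x,
    nabla.covEnd U Z x v - ⁅Phi x v, V x⁆ (Z x) + Phi x v (Z x) = 0
  nabla_g : nabla.KillsBilinHol g
  v_adj : ∀ (x : M) (a b : Tan E x), g x (V x a) b + g x a (V x b) = 0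
  phi_adj : ∀ (x : M) (v a b : Tan E x), g x (Phi x v a) b = g x a (Phi x v b)
  u_adj : ∀ (x : M) (a b : Tan E x), g x (U x a) b = g x a (U x b)

variable (E M) in
/-- A Frobenius (or Saito) manifold structure on `M`. -/
structure FrobeniusManifold extends SaitoStructure E M where
  torsion_free : nabla.IsTorsionFree
  phi_symm : ∀ (x : M) (v w : Tan E x), Phi x v w = Phi x w v
  e : Field E M
  e_hol : IsHolOn e Set.univ
  nabla_e : ∀ x : M, nabla e x = 0
  c : ℂ
  v_e : ∀ x : M, V x (e x) = c • e x
  phi_e : ∀ x : M, Phi x (e x) = -1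

namespace FrobeniusManifold

/-- The product `ξ ⋆ η = -Φ_ξ η`. -/
def mul (F : FrobeniusManifold E M) : EndForm E M := fun x => -F.Phi x

/-- The Euler field `U(e)`. -/
def euler (F : FrobeniusManifold E M) : Field E M := fun x => F.U x (F.e x)

end FrobeniusManifold

variable (E M) in
/-- A Frobenius manifold with an antilinear endomorphism `κ` of the tangent bundle and an
endomorphism `A†` of the tangent bundle. -/
structure PotentialRealData extends FrobeniusManifold E M where
  kappa : AntiEndField E M
  Adag : EndField E M

namespace PotentialRealData

/-- `h(a, b) = g(a, κ b)`. -/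
def h (F : PotentialRealData E M) : (x : M) → Tan E x → Tan E x → ℂ := herm F.g F.kappa

/-- The connection `D' = ∇ - [A†, Φ]`. -/
def D (F : PotentialRealData E M) : Connection10 E M :=
  F.nabla.addForm (fun x => -(LinearMap.mulLeft ℂ (F.Adag x) -
    LinearMap.mulRight ℂ (F.Adag x)).comp (F.Phi x))

theorem D_apply (F : PotentialRealData E M) (X : Field E M) (x : M) (v : Tan E x) :
    F.D X x v = F.nabla X x v - ⁅F.Adag x, F.Phi x v⁆ (X x) := by
  simp only [D, Connection10.addForm, LinearMap.add_apply, LinearMap.flip_apply,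
    LinearMap.neg_apply, LinearMap.comp_apply, LinearMap.mulLeft_apply,
    LinearMap.mulRight_apply, Ring.lie_def, sub_eq_add_neg]

/-- The endomorphism `Q = V + [A†, U]`. -/
def Q (F : PotentialRealData E M) : EndField E M := fun x => F.V x + ⁅F.Adag x, F.U x⁆

end PotentialRealData

variable (E M) in
/-- A harmonic Frobenius manifold: a harmonic potential real Saito structure on the tangent bundle,
with the conditions of a Frobenius manifold and a real eigenvalue `c`. -/
structure HarmonicFrobeniusManifold extends PotentialRealData E M where
  kappa_smooth : IsSmoothAntiEnd kappa
  kappa_sq : ∀ (x : M) (a : Tan E x), kappa x (kappa x a) = a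
  /-- `g` is real on the fixed vectors of `κ`. -/
  g_real : ∀ (x : M) (a b : Tan E x), kappa x a = a → kappa x b = b → (g x a b).im = 0
  adag_smooth : IsSmoothEnd Adag
  /-- `A†` is equal to its `g`-adjoint. -/
  adag_adj : ∀ (x : M) (a b : Tan E x), g x (Adag x a) b = g x a (Adag x b)
  PhiDag : EndAntiForm E M
  /-- `Φ† = d''(A†)`; this determines `Φ†`. -/
  phiDag_eq : ∀ (W : Set M) (Z : Field E M), IsOpen W → IsHolOn Z W → ∀ x ∈ W, ∀ v : Tan E x,
    PhiDag x v (Z x) = dbar (fun y => Adag y (Z y)) x v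
  /-- The Chern connection of `h` and the connection defined by `A†` coincide. -/
  d_chern : toPotentialRealData.D.IsChern toPotentialRealData.h
  d_g : toPotentialRealData.D.KillsBilin g
  /-- `Φ†` is the `h`-adjoint of `Φ`. -/
  phi_dagger : ∀ (x : M) (v a b : Tan E x),
    toPotentialRealData.h x (Phi x v a) b = toPotentialRealData.h x a (PhiDag x v b)
  harmonic : IsHarmonicHiggs toPotentialRealData.D Phi PhiDag
  /-- `Q` is equal to its `h`-adjoint. -/
  q_dagger : ∀ (x : M) (a b : Tan E x),
    toPotentialRealData.h x (toPotentialRealData.Q x a) b =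
      toPotentialRealData.h x a (toPotentialRealData.Q x b)
  c_real : c.im = 0

/-- `(M, mul, e, A, g)` is a Frobenius manifold with unit field `e`, Euler field `A`, metric `g`
with Levi-Civita connection `nabla`, and charge `d`. -/
structure IsFrobenius (nabla : Connection10 E M) (mul : EndForm E M) (e A : Field E M)
    (g : BilinField E M) (d : ℂ) : Prop where
  mul_hol : IsHolForm mul
  mul_comm : ∀ (x : M) (a b : Tan E x), mul x a b = mul x b a
  mul_assoc : ∀ (x : M) (a b c : Tan E x), mul x (mul x a b) c = mul x a (mul x b c)
  e_hol : IsHolOn e Set.univ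
  one_mul : ∀ (x : M) (a : Tan E x), mul x (e x) a = a
  euler_hol : IsHolOn A Set.univ
  g_hol : IsHolBilin g
  g_symm : ∀ (x : M) (a b : Tan E x), g x a b = g x b a
  g_nondeg : ∀ (x : M) (a : Tan E x), (∀ b, g x a b = 0) → a = 0
  g_mul : ∀ (x : M) (a b c : Tan E x), g x (mul x a b) c = g x a (mul x b c)
  nabla_hol : nabla.IsHol
  torsion_free : nabla.IsTorsionFree
  nabla_g : nabla.KillsBilinHol g
  flat : nabla.IsFlat
  nabla_e : ∀ x : M, nabla e x = 0
  /-- Potentiality: `(∇_X ∘)(Y, Z)` is symmetric in `X`, `Y`, `Z`. -/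
  potential : ∀ (W : Set M) (X Y Z : Field E M), IsOpen W → IsHolOn X W → IsHolOn Y W →
    IsHolOn Z W → ∀ x ∈ W,
    nabla (fun y => mul y (Y y) (Z y)) x (X x) - mul x (nabla Y x (X x)) (Z x)
        - mul x (Y x) (nabla Z x (X x)) =
      nabla (fun y => mul y (X y) (Z y)) x (Y x) - mul x (nabla X x (Y x)) (Z x)
        - mul x (X x) (nabla Z x (Y x))
  /-- `Lie_A(∘) = ∘`. -/
  lie_mul : ∀ (W : Set M) (X Y : Field E M), IsOpen W → IsHolOn X W → IsHolOn Y W → ∀ x ∈ W,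
    bracket A (fun y => mul y (X y) (Y y)) x - mul x (bracket A X x) (Y x)
      - mul x (X x) (bracket A Y x) = mul x (X x) (Y x)
  /-- `Lie_A(g) = (2 - d) g`. -/
  lie_g : ∀ (W : Set M) (X Y : Field E M), IsOpen W → IsHolOn X W → IsHolOn Y W → ∀ x ∈ W,
    del (fun y => g y (X y) (Y y)) x (A x) - g x (bracket A X x) (Y x)
      - g x (X x) (bracket A Y x) = (2 - d) * g x (X x) (Y x)

/-- The Frobenius manifold `(M, mul, e, A, g)` with the real structure `κ`, the Hermitian
form `h = g(·, κ ·)`, its Chern connection `D + d''`, the Higgs field `C_X Y = -X ∘ Y`, its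
conjugate `κ C κ`, the multiplication `A ∘` and the endomorphism `Q` form a CDV-structure. -/
structure IsCDV (nabla : Connection10 E M) (mul : EndForm E M) (e A : Field E M)
    (g : BilinField E M) (d : ℂ) (κ : AntiEndField E M) (D : Connection10 E M)
    (Q : EndField E M) : Prop where
  frobenius : IsFrobenius nabla mul e A g d
  d_real : d.im = 0
  kappa_smooth : IsSmoothAntiEnd κ
  kappa_sq : ∀ (x : M) (a : Tan E x), κ x (κ x a) = a
  h_hermitian : ∀ (x : M) (a b : Tan E x), herm g κ x b a = starRingEnd ℂ (herm g κ x a b)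
  h_nondeg : ∀ (x : M) (a : Tan E x), (∀ b, herm g κ x a b = 0) → a = 0
  h_real : ∀ (x : M) (a b : Tan E x),
    herm g κ x (κ x a) (κ x b) = starRingEnd ℂ (herm g κ x a b)
  D_smooth : D.IsSmooth
  chern : D.IsChern (herm g κ)
  D_g : D.KillsBilin g
  D_kappa : D.KillsReal κ
  /-- `κ C κ` is the `h`-adjoint of `C`. -/
  higgs_adj : ∀ (x : M) (v a b : Tan E x),
    herm g κ x ((-mul x) v a) b = herm g κ x a (conjEnd κ x ((-mul x) v) b)
  harmonic : IsHarmonicHiggs D (fun x => -mul x) (fun x v => conjEnd κ x ((-mul x) v))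
  lie_e_h : LieKills e (herm g κ)
  lie_euler_h : LieSubConjKills A (herm g κ)
  Q_smooth : IsSmoothEnd Q
  Q_eq : EqCovSubLie Q D A ((2 - d) / 2)
  Q_adj : ∀ (x : M) (a b : Tan E x), herm g κ x (Q x a) b = herm g κ x a (Q x b)
  Q_kappa : ∀ (x : M) (a : Tan E x), Q x (κ x a) = -κ x (Q x a)
  integrable : IsIntegrable D (fun x => -mul x) (fun x v => conjEnd κ x ((-mul x) v))
    (fun x => mul x (A x)) (fun x => conjEnd κ x (mul x (A x))) Q

end Structures

end HarmonicFrobenius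

end

/-! The Frobenius axioms are obtained by evaluating the Saito equations at `e`. Since `Φ_v e = -v`
and `U` commutes with `Φ`, multiplication by `U e` is `U`. The equation for `∇U`, applied to `e`,
gives `∇_v E = (1 - c) v + V v` for the Euler field `E` (`nabla_euler`). Torsion-freeness turns
brackets with `E` into covariant derivatives. The `V`-terms then cancel in `Lie_E(∘)`, and in
`Lie_E(g)` they cancel because `V` is `g`-skew. What remains is the factor `2 - 2c`, hence `d = 2c`.

The Hermitian side rests on three facts. Comparing the Chern identity for `h = g(·, κ·)` with `D'(g)
= 0` gives `D' κ = κ d''` (`D_kappa`). As `Φ` is `g`-selfadjoint, its `h`-adjoint is `κΦκ`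
(`phiDag_eq_conjEnd`). As `Q` is `g`-skew and `h`-selfadjoint, it anticommutes with `κ` (`Q_kappa`).
Moreover `Φ_E = -U` turns `D' = ∇ - [A†, Φ]` into `D_E = Lie_E + (1 - c) + Q` on holomorphic fields
(`D_euler`), which gives (e). Together with the reality of `c` and the `h`-selfadjointness of `Q`,
it also gives invariance of `h` under `E - Ē`.

For integrability, `D'(U)` follows from the Saito equation and a Jacobi identity (`D_cov_U`), and
`d''(Q)` from `d''A† = Φ†` (`dbar_Q`). The conjugate equations follow by conjugation with `κ`, which
exchanges `D'` with `d''`, `Φ` with `Φ†`, `U` with `U†` and `Q` with `-Q`. Since `κ` destroys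
holomorphy, identities known on holomorphic fields must first be extended to smooth ones; this is
the role of `eq_zero_of_tensorial` and the calculus before it. -/

noncomputable section

namespace HarmonicFrobenius

/-! ### Holomorphic maps of several variables are smooth. -/

section HolomorphicSmooth

open Metric Set Filter Topology MeasureTheory

variable {E F : Type*} [NormedAddCommGroup E] [NormedSpace ℂ E] [FiniteDimensional ℂ E]
  [NormedAddCommGroup F] [NormedSpace ℂ F] [FiniteDimensional ℂ F]

/-- The directional derivatives of a holomorphic map of several variables are holomorphic. -/
theorem differentiableOn_fderiv_apply {f : E → F} {U : Set E} (hU : IsOpen U)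
    (hf : DifferentiableOn ℂ f U) (v : E) : DifferentiableOn ℂ (fun z => fderiv ℂ f z v) U := by
  intro z₀ hz₀
  refine DifferentiableAt.differentiableWithinAt ?_
  have hc : ContinuousAt f z₀ := (hf.differentiableAt (hU.mem_nhds hz₀)).continuousAt
  obtain ⟨R, hR, hRU⟩ : ∃ R > 0, ball z₀ R ⊆ U ∩ f ⁻¹' ball (f z₀) 1 :=
    Metric.mem_nhds_iff.1 (inter_mem (hU.mem_nhds hz₀) (hc (ball_mem_nhds _ one_pos)))
  have hdiff : ∀ w ∈ ball z₀ R, DifferentiableAt ℂ f w := fun w hw =>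
    hf.differentiableAt (hU.mem_nhds (hRU hw).1)
  have hcont : ContinuousOn f (ball z₀ R) := fun w hw =>
    (hdiff w hw).continuousAt.continuousWithinAt
  -- A third of `R` leaves room for two steps: discs of radius `r` about points of the ball of
  -- radius `2 * r` still lie where `f` stays within distance 1 of `f z₀`. Two such values differ by
  -- at most 2, so Cauchy's estimate yields the uniform bound `2 / r`.
  set r := R / 3 with hr
  have hr0 : 0 < r := by positivity
  have hbound : ∀ w ∈ ball z₀ (2 * r), ‖fderiv ℂ f w‖ ≤ 2 / r := by
    intro w hw
    have hsub : ball w r ⊆ ball z₀ R := by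
      intro y hy
      rw [mem_ball] at *
      linarith [dist_triangle y w z₀]
    refine Complex.norm_fderiv_le_div_of_mapsTo_ball (hf.mono fun y hy => (hRU (hsub hy)).1)
      (fun y hy => ?_) hr0
    have h1 : dist (f y) (f z₀) < 1 := (hRU (hsub hy)).2
    have h2 : dist (f w) (f z₀) < 1 := (hRU (hsub (mem_ball_self hr0))).2
    rw [mem_closedBall]
    linarith [dist_triangle_right (f y) (f w) (f z₀)]
  obtain ⟨ρ, hρ, hρv⟩ : ∃ ρ > 0, ρ * ‖v‖ < r := by
    refine ⟨r / (‖v‖ + 1), by positivity, ?_⟩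
    rw [div_mul_eq_mul_div, div_lt_iff₀ (by positivity)]
    nlinarith [norm_nonneg v]
  have hmem : ∀ z ∈ ball z₀ r, ∀ c : ℂ, ‖c‖ ≤ ρ → z + c • v ∈ ball z₀ (2 * r) := by
    intro z hz c hc
    rw [mem_ball, dist_eq_norm] at *
    have h1 : ‖c • v‖ ≤ ρ * ‖v‖ := by
      rw [norm_smul]; exact mul_le_mul_of_nonneg_right hc (norm_nonneg _)
    calc ‖z + c • v - z₀‖ = ‖(z - z₀) + c • v‖ := by congr 1; abel
      _ ≤ ‖z - z₀‖ + ‖c • v‖ := norm_add_le _ _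
      _ < 2 * r := by linarith
  have hsub2 : ball z₀ (2 * r) ⊆ ball z₀ R := ball_subset_ball (by linarith)
  have hcirc : ∀ θ : ℝ, ‖circleMap 0 ρ θ‖ ≤ ρ := fun θ => by
    rw [norm_circleMap_zero, abs_of_pos hρ]
  have hline : ∀ z (c : ℂ), HasDerivAt (fun c : ℂ => z + c • v) v c := fun z c => by
    simpa using ((hasDerivAt_id c).smul_const v).const_add z
  -- The kernel of Cauchy's formula for the first derivative at 0 of `c ↦ f (z + c • v)`, on a
  -- circle of radius `ρ` independent of `z`. The formula expresses the directional derivative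
  -- through values of `f`, so it can be differentiated again under the integral.
  set a : ℝ → ℂ := fun θ => deriv (circleMap 0 ρ) θ * (1 / (circleMap 0 ρ θ) ^ 2) with ha
  have ha_cont : Continuous a := by
    have hne : ∀ θ : ℝ, (circleMap 0 ρ θ) ^ 2 ≠ 0 := fun θ =>
      pow_ne_zero _ (circleMap_ne_center hρ.ne')
    simp only [ha, deriv_circleMap]
    exact ((continuous_circleMap 0 ρ).mul continuous_const).mul
      (continuous_const.div ((continuous_circleMap 0 ρ).pow 2) hne)
  have hcont_z : ∀ z ∈ ball z₀ r, Continuous fun θ : ℝ => a θ • f (z + circleMap 0 ρ θ • v) := by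
    intro z hz
    refine ha_cont.smul (hcont.comp_continuous (by fun_prop) fun θ => hsub2 (hmem z hz _ (hcirc θ)))
  have hformula : ∀ z ∈ ball z₀ r, fderiv ℂ f z v = (2 * Real.pi * Complex.I : ℂ)⁻¹ •
      ∫ θ in (0 : ℝ)..2 * Real.pi, a θ • f (z + circleMap 0 ρ θ • v) := by
    intro z hz
    have hd : DifferentiableOn ℂ (fun c : ℂ => f (z + c • v)) (closedBall 0 ρ) := by
      intro c hc
      have hcm : z + c • v ∈ ball z₀ R :=
        hsub2 (hmem z hz c (by simpa using hc))
      exact ((hdiff _ hcm).comp c (hline z c).differentiableAt).differentiableWithinAt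
    have h1 := hd.deriv_eq_smul_circleIntegral hρ
    have h2 : deriv (fun c : ℂ => f (z + c • v)) 0 = fderiv ℂ f z v := by
      have hz' : DifferentiableAt ℂ f (z + (0 : ℂ) • v) := by
        simpa using hdiff z (ball_subset_ball (by linarith) hz)
      have := hz'.hasFDerivAt.comp_hasDerivAt (0 : ℂ) (hline z 0)
      have h := this.deriv
      rw [zero_smul, add_zero] at h
      exact h
    rw [h2] at h1
    have hpi : (2 * Real.pi * Complex.I : ℂ) ≠ 0 := Complex.two_pi_I_ne_zero
    rw [eq_inv_smul_iff₀ hpi, ← h1, circleIntegral]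
    simp only [ha, smul_smul, sub_zero]
  have key : HasFDerivAt (fun z => ∫ θ in (0 : ℝ)..2 * Real.pi, a θ • f (z + circleMap 0 ρ θ • v))
      (∫ θ in (0 : ℝ)..2 * Real.pi, a θ • fderiv ℂ f (z₀ + circleMap 0 ρ θ • v)) z₀ := by
    borelize E (E →L[ℂ] F)
    refine intervalIntegral.hasFDerivAt_integral_of_dominated_of_fderiv_le
      (F' := fun z θ => a θ • fderiv ℂ f (z + circleMap 0 ρ θ • v))
      (bound := fun θ => ‖a θ‖ * (2 / r)) (ball_mem_nhds z₀ hr0) ?_ ?_ ?_ ?_ ?_ ?_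
    · filter_upwards [ball_mem_nhds z₀ hr0] with z hz
      exact (hcont_z z hz).aestronglyMeasurable
    · exact (hcont_z z₀ (mem_ball_self hr0)).intervalIntegrable _ _
    · refine (ha_cont.aestronglyMeasurable).smul ?_
      -- Continuity of the derivative is not yet available; a derivative is measurable without it.
      refine Measurable.aestronglyMeasurable ?_
      exact (measurable_fderiv ℂ f).comp (Continuous.measurable (by fun_prop))
    · refine ae_of_all _ fun θ _ z hz => ?_
      rw [norm_smul]
      exact mul_le_mul_of_nonneg_left (hbound _ (hmem z hz _ (hcirc θ))) (norm_nonneg _)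
    · exact (ha_cont.norm.mul continuous_const).intervalIntegrable _ _
    · refine ae_of_all _ fun θ _ z hz => ?_
      have h1 := (hdiff _ (hsub2 (hmem z hz _ (hcirc θ)))).hasFDerivAt
      exact (h1.comp z ((hasFDerivAt_id z).add_const _)).const_smul (a θ)
  refine (key.differentiableAt.const_smul (2 * Real.pi * Complex.I : ℂ)⁻¹).congr_of_eventuallyEq ?_
  filter_upwards [ball_mem_nhds z₀ hr0] with z hz using hformula z hz

/-- Holomorphic maps of several variables are infinitely differentiable. -/
theorem contDiffOn_of_differentiableOn_complex {f : E → F} {U : Set E} (hU : IsOpen U)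
    (hf : DifferentiableOn ℂ f U) : ContDiffOn ℂ ∞ f U := by
  rw [contDiffOn_infty]
  intro n
  induction n generalizing f with
  | zero => exact contDiffOn_zero.2 hf.continuousOn
  | succ n ih =>
    rw [Nat.cast_succ, contDiffOn_succ_iff_fderiv_of_isOpen hU]
    -- In finite dimension the derivative is as regular as its values on fixed vectors, and these
    -- are again holomorphic.
    refine ⟨hf, by simp, contDiffOn_clm_apply.2 fun v => ih (differentiableOn_fderiv_apply hU hf v)⟩

end HolomorphicSmooth

/-! ### The operators `∂` and `∂̄` on functions, computed in charts. -/

section CalculusLemmas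

open Set Filter Topology

variable {E : Type*} [NormedAddCommGroup E] [NormedSpace ℂ E]
  {M : Type*} [TopologicalSpace M] [ChartedSpace E M]
  {F : Type*} [NormedAddCommGroup F] [NormedSpace ℂ F]

/-- The tangent space at `x` is modelled on `E` through the preferred chart at `x`, so no coordinate
change intervenes. -/
theorem mfderiv_eq_fderiv_chart {f : M → F} {x : M} (hf : MDifferentiableAt 𝓘(ℝ, E) 𝓘(ℝ, F) f x) :
    (mfderiv 𝓘(ℝ, E) 𝓘(ℝ, F) f x : E → F) =
      fderiv ℝ (f ∘ (chartAt E x).symm) (chartAt E x x) := by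
  rw [hf.mfderiv, modelWithCornersSelf_coe, range_id, fderivWithin_univ]
  rfl

theorem differentiableAt_chart {f : M → F} {x : M}
    (hf : MDifferentiableAt 𝓘(ℝ, E) 𝓘(ℝ, F) f x) :
    DifferentiableAt ℝ (f ∘ (chartAt E x).symm) (chartAt E x x) := by
  have h := ((mdifferentiableAt_iff f x).1 hf).2
  rw [modelWithCornersSelf_coe, range_id, differentiableWithinAt_univ] at h
  exact h

omit [NormedSpace ℂ E] in
theorem chart_symm_self (x : M) : (chartAt E x).symm (chartAt E x x) = x :=
  (chartAt E x).left_inv (mem_chart_source E x)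

theorem del_eq_chart {f : M → F} {x : M} (hf : MDifferentiableAt 𝓘(ℝ, E) 𝓘(ℝ, F) f x) (v : E) :
    del f x v = (1 / 2 : ℂ) • (fderiv ℝ (f ∘ (chartAt E x).symm) (chartAt E x x) v -
      Complex.I • fderiv ℝ (f ∘ (chartAt E x).symm) (chartAt E x x) (Complex.I • v)) := by
  rw [← mfderiv_eq_fderiv_chart hf]
  rfl

theorem delbar_eq_chart {f : M → F} {x : M} (hf : MDifferentiableAt 𝓘(ℝ, E) 𝓘(ℝ, F) f x) (v : E) :
    delbar f x v = (1 / 2 : ℂ) • (fderiv ℝ (f ∘ (chartAt E x).symm) (chartAt E x x) v +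
      Complex.I • fderiv ℝ (f ∘ (chartAt E x).symm) (chartAt E x x) (Complex.I • v)) := by
  rw [← mfderiv_eq_fderiv_chart hf]
  rfl

theorem del_congr {f g : M → F} {x : M} (h : f =ᶠ[𝓝 x] g) (v : Tan E x) :
    del f x v = del g x v := by
  have := h.mfderiv_eq (I := 𝓘(ℝ, E)) (I' := 𝓘(ℝ, F))
  unfold del
  rw [this]
  rfl

theorem delbar_congr {f g : M → F} {x : M} (h : f =ᶠ[𝓝 x] g) (v : Tan E x) :
    delbar f x v = delbar g x v := by
  have := h.mfderiv_eq (I := 𝓘(ℝ, E)) (I' := 𝓘(ℝ, F))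
  unfold delbar
  rw [this]
  rfl

theorem del_const (c : F) (x : M) (v : Tan E x) : del (fun _ : M => c) x v = 0 := by
  have : mfderiv 𝓘(ℝ, E) 𝓘(ℝ, F) (fun _ : M => c) x = 0 := mfderiv_const
  unfold del
  rw [this]
  change (1 / 2 : ℂ) • ((0 : F) - Complex.I • (0 : F)) = 0
  simp

theorem delbar_add {f g : M → F} {x : M} (hf : MDifferentiableAt 𝓘(ℝ, E) 𝓘(ℝ, F) f x)
    (hg : MDifferentiableAt 𝓘(ℝ, E) 𝓘(ℝ, F) g x) (v : Tan E x) :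
    delbar (fun y => f y + g y) x v = delbar f x v + delbar g x v := by
  revert v
  intro (v : E)
  have hfg : MDifferentiableAt 𝓘(ℝ, E) 𝓘(ℝ, F) (fun y => f y + g y) x := hf.add hg
  have h : fderiv ℝ ((fun y => f y + g y) ∘ (chartAt E x).symm) (chartAt E x x) = _ :=
    ((differentiableAt_chart hf).hasFDerivAt.add (differentiableAt_chart hg).hasFDerivAt).fderiv
  rw [delbar_eq_chart hf, delbar_eq_chart hg, delbar_eq_chart hfg, h]
  simp only [add_apply]
  module

theorem mdifferentiableAt_real_smul {f : M → ℂ} {g : M → F} {x : M}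
    (hf : MDifferentiableAt 𝓘(ℝ, E) 𝓘(ℝ, ℂ) f x) (hg : MDifferentiableAt 𝓘(ℝ, E) 𝓘(ℝ, F) g x) :
    MDifferentiableAt 𝓘(ℝ, E) 𝓘(ℝ, F) (fun y => f y • g y) x := by
  rw [mdifferentiableAt_iff] at *
  exact ⟨hf.1.smul hg.1, hf.2.smul hg.2⟩

theorem delbar_smul {f : M → ℂ} {g : M → F} {x : M} (hf : MDifferentiableAt 𝓘(ℝ, E) 𝓘(ℝ, ℂ) f x)
    (hg : MDifferentiableAt 𝓘(ℝ, E) 𝓘(ℝ, F) g x) (v : Tan E x) :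
    delbar (fun y => f y • g y) x v = f x • delbar g x v + delbar f x v • g x := by
  revert v
  intro (v : E)
  have h : fderiv ℝ ((fun y => f y • g y) ∘ (chartAt E x).symm) (chartAt E x x) = _ :=
    ((differentiableAt_chart hf).hasFDerivAt.smul (differentiableAt_chart hg).hasFDerivAt).fderiv
  rw [delbar_eq_chart hf, delbar_eq_chart hg,
    delbar_eq_chart (mdifferentiableAt_real_smul hf hg), h]
  simp only [add_apply, smul_apply,
    ContinuousLinearMap.smulRight_apply, Function.comp_apply, chart_symm_self]
  module

/-- Conjugation is real linear and sends `i` to `-i`, which interchanges the two types of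
derivative. -/
theorem delbar_conj {f : M → ℂ} {x : M} (hf : MDifferentiableAt 𝓘(ℝ, E) 𝓘(ℝ, ℂ) f x)
    (v : Tan E x) :
    delbar (fun y => starRingEnd ℂ (f y)) x v = starRingEnd ℂ (del f x v) := by
  revert v
  intro (v : E)
  have hf' : MDifferentiableAt 𝓘(ℝ, E) 𝓘(ℝ, ℂ) (fun y => starRingEnd ℂ (f y)) x := by
    rw [mdifferentiableAt_iff] at *
    refine ⟨Complex.continuous_conj.continuousAt.comp hf.1, ?_⟩
    exact (Complex.conjCLE : ℂ →L[ℝ] ℂ).differentiableAt.comp_differentiableWithinAt _ hf.2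
  have h : fderiv ℝ ((fun y => starRingEnd ℂ (f y)) ∘ (chartAt E x).symm) (chartAt E x x) =
      (Complex.conjCLE : ℂ →L[ℝ] ℂ).comp
        (fderiv ℝ (f ∘ (chartAt E x).symm) (chartAt E x x)) :=
    ((Complex.conjCLE : ℂ →L[ℝ] ℂ).hasFDerivAt.comp _
      (differentiableAt_chart hf).hasFDerivAt).fderiv
  rw [delbar_eq_chart hf', del_eq_chart hf, h]
  simp [map_ofNat]

/-- Cauchy–Riemann: the differential is complex linear, so `df(v) + i df(iv)` cancels. -/
theorem delbar_eq_zero {f : M → F} {x : M} (hf : MDifferentiableAt 𝓘(ℂ, E) 𝓘(ℂ, F) f x)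
    (v : Tan E x) : delbar f x v = 0 := by
  revert v
  intro (v : E)
  have h := (mdifferentiableAt_iff f x).1 hf
  have hd : DifferentiableAt ℂ (f ∘ (chartAt E x).symm) (chartAt E x x) := by
    have h2 := h.2
    rw [modelWithCornersSelf_coe, range_id, differentiableWithinAt_univ] at h2
    exact h2
  have hR : MDifferentiableAt 𝓘(ℝ, E) 𝓘(ℝ, F) f x := by
    rw [mdifferentiableAt_iff]
    refine ⟨h.1, ?_⟩
    rw [modelWithCornersSelf_coe, range_id, differentiableWithinAt_univ]
    exact hd.restrictScalars ℝ
  rw [delbar_eq_chart hR, hd.fderiv_restrictScalars ℝ]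
  simp [smul_smul]

variable [IsManifold 𝓘(ℂ, E) ω M]

variable (E M) in
theorem isManifold_real : IsManifold 𝓘(ℝ, E) ∞ M := by
  refine isManifold_of_contDiffOn _ _ _ fun e e' he he' => ?_
  have h := StructureGroupoid.compatible (contDiffGroupoid ω 𝓘(ℂ, E)) he he'
  rw [contDiffGroupoid, mem_groupoid_of_pregroupoid] at h
  have h1 := h.1
  simp only [contDiffPregroupoid, modelWithCornersSelf_coe, modelWithCornersSelf_coe_symm] at h1 ⊢
  exact (h1.of_le le_top).restrict_scalars ℝ

theorem contMDiffAt_real_iff {f : M → F} {x₀ y : M} (hy : y ∈ (chartAt E x₀).source) :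
    ContMDiffAt 𝓘(ℝ, E) 𝓘(ℝ, F) ∞ f y ↔
      ContDiffAt ℝ ∞ (f ∘ (chartAt E x₀).symm) (chartAt E x₀ y) := by
  have := isManifold_real E M
  rw [contMDiffAt_iff_source_of_mem_source hy, modelWithCornersSelf_coe, range_id,
    contMDiffWithinAt_univ, contMDiffAt_iff_contDiffAt]
  rfl

theorem mdifferentiableAt_complex_iff {f : M → F} {x₀ y : M} (hy : y ∈ (chartAt E x₀).source) :
    MDifferentiableAt 𝓘(ℂ, E) 𝓘(ℂ, F) f y ↔
      DifferentiableAt ℂ (f ∘ (chartAt E x₀).symm) (chartAt E x₀ y) := by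
  have : IsManifold 𝓘(ℂ, E) 1 M := IsManifold.of_le (n := ω) le_top
  rw [mdifferentiableAt_iff_source_of_mem_source hy, modelWithCornersSelf_coe, range_id,
    mdifferentiableWithinAt_univ, mdifferentiableAt_iff_differentiableAt]
  rfl

theorem contMDiffAt_of_mdifferentiableOn [FiniteDimensional ℂ E] [FiniteDimensional ℂ F]
    {f : M → F} {W : Set M} (hW : IsOpen W) (hf : MDifferentiableOn 𝓘(ℂ, E) 𝓘(ℂ, F) f W)
    {y : M} (hy : y ∈ W) : ContMDiffAt 𝓘(ℝ, E) 𝓘(ℝ, F) ∞ f y := by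
  have hys := mem_chart_source E y
  rw [contMDiffAt_real_iff hys]
  set φ := chartAt E y
  have hU : IsOpen (φ.target ∩ φ.symm ⁻¹' W) := φ.isOpen_inter_preimage_symm hW
  have hd : DifferentiableOn ℂ (f ∘ φ.symm) (φ.target ∩ φ.symm ⁻¹' W) := by
    rintro z ⟨hz, hzW⟩
    have h := (mdifferentiableAt_complex_iff (φ.map_target hz)).1
      ((hf _ hzW).mdifferentiableAt (hW.mem_nhds hzW))
    change DifferentiableAt ℂ (f ∘ φ.symm) (φ (φ.symm z)) at h
    rw [φ.right_inv hz] at h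
    exact h.differentiableWithinAt
  refine ((contDiffOn_of_differentiableOn_complex hU hd).contDiffAt
    (hU.mem_nhds ⟨φ.map_source hys, ?_⟩)).restrict_scalars ℝ
  rwa [mem_preimage, φ.left_inv hys]

end CalculusLemmas

/-! ### Vector fields in coordinates, holomorphic frames, and the operator `d''`. -/

section FieldLemmas

open Set Filter Topology

variable {E : Type*} [NormedAddCommGroup E] [NormedSpace ℂ E]
  {M : Type*} [TopologicalSpace M] [ChartedSpace E M] [IsManifold 𝓘(ℂ, E) ω M]

theorem coord_eq (X : Field E M) (x y : M) :
    coord X x y = tangentCoordChange 𝓘(ℂ, E) y x y (X y) := rfl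

theorem coord_congr {X Y : Field E M} {y : M} (h : X y = Y y) (x : M) :
    coord X x y = coord Y x y := by
  rw [coord_eq, coord_eq, h]

theorem coord_add (X Y : Field E M) (x y : M) :
    coord (fun z => X z + Y z) x y = coord X x y + coord Y x y :=
  map_add (tangentCoordChange 𝓘(ℂ, E) y x y) (X y) (Y y)

theorem coord_smul (f : M → ℂ) (X : Field E M) (x y : M) :
    coord (fun z => f z • X z) x y = f y • coord X x y :=
  map_smul (tangentCoordChange 𝓘(ℂ, E) y x y) (f y) (X y)

theorem coord_sum {ι : Type*} (s : Finset ι) (X : ι → Field E M) (x y : M) :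
    coord (fun z => ∑ i ∈ s, X i z) x y = ∑ i ∈ s, coord (X i) x y :=
  map_sum (tangentCoordChange 𝓘(ℂ, E) y x y) (fun i => X i y) s

theorem trivializationAt_symm_coord (X : Field E M) {x y : M} (hy : y ∈ (chartAt E x).source) :
    (trivializationAt E (TangentSpace 𝓘(ℂ, E) : M → Type _) x).symm y (coord X x y) = X y :=
  (trivializationAt E (TangentSpace 𝓘(ℂ, E) : M → Type _) x).symm_apply_apply_mk hy (X y)

theorem coord_self (X : Field E M) (x : M) : coord X x x = X x :=
  tangentCoordChange_self (I := 𝓘(ℂ, E)) (by simp)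

/-- The trivialization centred at `x` is the identity on the fibre over `x`, so undoing it there
changes nothing. -/
theorem dbar_eq (X : Field E M) (x : M) (v : Tan E x) : dbar X x v = delbar (coord X x) x v := by
  have h := trivializationAt_symm_coord (fun _ => delbar (F := E) (coord X x) x v : Field E M)
    (mem_chart_source E x)
  exact (congrArg _ (coord_self (fun _ => delbar (F := E) (coord X x) x v : Field E M) x)).symm.trans h

/-- The vector field with constant coordinates `u` in the preferred chart at `x`. -/
def constField (x : M) (u : E) : Field E M := fun y =>
  (trivializationAt E (TangentSpace 𝓘(ℂ, E) : M → Type _) x).symm y u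

theorem coord_constField {x y : M} (hy : y ∈ (chartAt E x).source) (u : E) :
    coord (constField x u) x y = u :=
  congrArg Prod.snd
    ((trivializationAt E (TangentSpace 𝓘(ℂ, E) : M → Type _) x).apply_mk_symm hy u)

theorem constField_self (x : M) (u : E) : constField x u x = u := by
  rw [← coord_self (constField x u) x, coord_constField (mem_chart_source E x)]

theorem isHolOn_iff_coord {X : Field E M} {W : Set M} (hW : IsOpen W) {x : M}
    (h : W ⊆ (chartAt E x).source) :
    IsHolOn X W ↔ MDifferentiableOn 𝓘(ℂ, E) 𝓘(ℂ, E) (coord X x) W := by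
  have : IsManifold 𝓘(ℂ, E) (1 + 1) M := IsManifold.of_le (n := ω) le_top
  have : ContMDiffVectorBundle 1 E (TangentSpace 𝓘(ℂ, E) : M → Type _) 𝓘(ℂ, E) :=
    TangentBundle.contMDiffVectorBundle
  exact (trivializationAt E (TangentSpace 𝓘(ℂ, E) : M → Type _) x).mdifferentiableOn_section_iff
    hW h

theorem IsHolOn.mono {X : Field E M} {W W' : Set M} (hX : IsHolOn X W) (h : W' ⊆ W) :
    IsHolOn X W' :=
  MDifferentiableOn.mono hX h

theorem isHolOn_constField (x : M) (u : E) : IsHolOn (constField x u) (chartAt E x).source := by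
  rw [isHolOn_iff_coord (chartAt E x).open_source subset_rfl]
  exact (mdifferentiableOn_const (c := u)).congr fun y hy => coord_constField hy u

theorem exists_isHolOn_eq (x : M) (a : Tan E x) :
    ∃ X : Field E M, IsHolOn X (chartAt E x).source ∧ X x = a :=
  ⟨_, isHolOn_constField (E := E) x a, constField_self (E := E) x a⟩

theorem IsHolOn.mdifferentiableOn_coord {X : Field E M} {W : Set M} (hX : IsHolOn X W)
    (hW : IsOpen W) (x : M) :
    MDifferentiableOn 𝓘(ℂ, E) 𝓘(ℂ, E) (coord X x) (W ∩ (chartAt E x).source) :=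
  (isHolOn_iff_coord (hW.inter (chartAt E x).open_source) inter_subset_right).1
    (hX.mono inter_subset_left)

theorem isHolOn_of_coord {X : Field E M} {W : Set M} (hW : IsOpen W)
    (h : ∀ x ∈ W, MDifferentiableOn 𝓘(ℂ, E) 𝓘(ℂ, E) (coord X x) (W ∩ (chartAt E x).source)) :
    IsHolOn X W := by
  intro x hx
  have hU := hW.inter (chartAt E x).open_source
  have hxU : x ∈ W ∩ (chartAt E x).source := ⟨hx, mem_chart_source E x⟩
  exact (((isHolOn_iff_coord hU inter_subset_right).2 (h x hx) x hxU).mdifferentiableAt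
    (hU.mem_nhds hxU)).mdifferentiableWithinAt

theorem IsHolOn.neg {X : Field E M} {W : Set M} (hX : IsHolOn X W) (hW : IsOpen W) :
    IsHolOn (fun y => -X y) W := by
  refine isHolOn_of_coord hW fun x _ => (hX.mdifferentiableOn_coord hW x).neg.congr fun y _ => ?_
  exact map_neg (tangentCoordChange 𝓘(ℂ, E) y x y) (X y)

theorem IsHolOn.dbar_eq_zero {X : Field E M} {W : Set M} (hX : IsHolOn X W) (hW : IsOpen W)
    {x : M} (hx : x ∈ W) (v : Tan E x) : dbar X x v = 0 := by
  have hU := hW.inter (chartAt E x).open_source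
  have hxU : x ∈ W ∩ (chartAt E x).source := ⟨hx, mem_chart_source E x⟩
  rw [dbar_eq]
  exact delbar_eq_zero
    ((hX.mdifferentiableOn_coord hW x x hxU).mdifferentiableAt (hU.mem_nhds hxU)) v

/-! ### Smooth vector fields -/

theorem IsSmoothOn.mono {X : Field E M} {W W' : Set M} (hX : IsSmoothOn X W) (h : W' ⊆ W) :
    IsSmoothOn X W' :=
  fun x hx => hX x (h hx)

theorem IsSmoothOn.congr {X Y : Field E M} {W : Set M} (hW : IsOpen W) (hX : IsSmoothOn X W)
    (h : ∀ y ∈ W, Y y = X y) : IsSmoothOn Y W := by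
  refine fun x hx => (hX x hx).congr_of_eventuallyEq ?_
  filter_upwards [hW.mem_nhds hx] with y hy using coord_congr (h y hy) x

theorem isSmoothOn_of_locally {X : Field E M} {W : Set M}
    (h : ∀ x ∈ W, ∃ W', x ∈ W' ∧ IsSmoothOn X W') : IsSmoothOn X W := by
  intro x hx
  obtain ⟨W', hx', hX⟩ := h x hx
  exact hX x hx'

theorem IsSmoothOn.add {X Y : Field E M} {W : Set M} (hX : IsSmoothOn X W)
    (hY : IsSmoothOn Y W) : IsSmoothOn (fun y => X y + Y y) W := by
  intro x hx
  refine ((hX x hx).add (hY x hx)).congr_of_eventuallyEq ?_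
  exact Eventually.of_forall fun y => coord_add X Y x y

theorem contMDiffAt_real_smul {F : Type*} [NormedAddCommGroup F] [NormedSpace ℂ F]
    {f : M → ℂ} {g : M → F} {x : M} (hf : ContMDiffAt 𝓘(ℝ, E) 𝓘(ℝ, ℂ) ∞ f x)
    (hg : ContMDiffAt 𝓘(ℝ, E) 𝓘(ℝ, F) ∞ g x) :
    ContMDiffAt 𝓘(ℝ, E) 𝓘(ℝ, F) ∞ (fun y => f y • g y) x := by
  have hx := mem_chart_source E x
  rw [contMDiffAt_real_iff hx] at *
  exact hf.smul hg

omit [IsManifold 𝓘(ℂ, E) ω M] in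
theorem IsSmoothFunOn.contMDiffAt {f : M → ℂ} {W : Set M} (hf : IsSmoothFunOn (E := E) f W)
    (hW : IsOpen W) {x : M} (hx : x ∈ W) : ContMDiffAt 𝓘(ℝ, E) 𝓘(ℝ, ℂ) ∞ f x :=
  ContMDiffOn.contMDiffAt hf (hW.mem_nhds hx)

theorem IsSmoothOn.smul {f : M → ℂ} {X : Field E M} {W : Set M} (hW : IsOpen W)
    (hf : IsSmoothFunOn (E := E) f W) (hX : IsSmoothOn X W) :
    IsSmoothOn (fun y => f y • X y) W := by
  intro x hx
  refine (contMDiffAt_real_smul (hf.contMDiffAt hW hx) (hX x hx)).congr_of_eventuallyEq ?_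
  exact Eventually.of_forall fun y => coord_smul f X x y

omit [IsManifold 𝓘(ℂ, E) ω M] in
theorem isSmoothFunOn_const (c : ℂ) (W : Set M) : IsSmoothFunOn (E := E) (fun _ => c) W :=
  contMDiffOn_const

theorem IsSmoothOn.neg {X : Field E M} {W : Set M} (hW : IsOpen W) (hX : IsSmoothOn X W) :
    IsSmoothOn (fun y => -X y) W := by
  simpa using hX.smul hW (isSmoothFunOn_const (-1) W)

theorem isSmoothOn_zero (W : Set M) : IsSmoothOn (fun y => (0 : Tan E y)) W := by
  intro x _
  refine (contMDiffAt_const (c := (0 : E))).congr_of_eventuallyEq ?_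
  exact Eventually.of_forall fun y => map_zero (tangentCoordChange 𝓘(ℂ, E) y x y)

theorem IsSmoothOn.sum {ι : Type*} (s : Finset ι) {X : ι → Field E M} {W : Set M}
    (hX : ∀ i, IsSmoothOn (X i) W) : IsSmoothOn (fun y => ∑ i ∈ s, X i y) W := by
  classical
  induction s using Finset.induction_on with
  | empty => simpa using isSmoothOn_zero W
  | insert i s hi ih =>
    simp only [Finset.sum_insert hi]
    exact (hX i).add ih

theorem dbar_add {X Y : Field E M} {W : Set M} (hX : IsSmoothOn X W) (hY : IsSmoothOn Y W)
    {x : M} (hx : x ∈ W) (v : Tan E x) :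
    dbar (fun y => X y + Y y) x v = dbar X x v + dbar Y x v := by
  rw [dbar_eq, dbar_eq, dbar_eq, delbar_congr (Eventually.of_forall fun y => coord_add X Y x y)]
  exact delbar_add ((hX x hx).mdifferentiableAt (by simp)) ((hY x hx).mdifferentiableAt (by simp)) v

theorem dbar_smul {f : M → ℂ} {X : Field E M} {W : Set M} (hW : IsOpen W)
    (hf : IsSmoothFunOn (E := E) f W) (hX : IsSmoothOn X W) {x : M} (hx : x ∈ W) (v : Tan E x) :
    dbar (fun y => f y • X y) x v = f x • dbar X x v + delbar f x v • X x := by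
  rw [dbar_eq, dbar_eq, delbar_congr (Eventually.of_forall fun y => coord_smul f X x y),
    delbar_smul ((hf.contMDiffAt hW hx).mdifferentiableAt (by simp))
      ((hX x hx).mdifferentiableAt (by simp)) v, coord_self]
  rfl

theorem dbar_congr {X Y : Field E M} {W : Set M} (hW : IsOpen W) (h : ∀ y ∈ W, X y = Y y)
    {x : M} (hx : x ∈ W) (v : Tan E x) : dbar X x v = dbar Y x v := by
  rw [dbar_eq, dbar_eq]
  refine delbar_congr (F := E) ?_ v
  filter_upwards [hW.mem_nhds hx] with y hy using coord_congr (h y hy) x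

theorem dbar_neg {X : Field E M} {W : Set M} (hW : IsOpen W) (hX : IsSmoothOn X W)
    {x : M} (hx : x ∈ W) (v : Tan E x) : dbar (fun y => -X y) x v = -dbar X x v := by
  have h := dbar_smul hW (isSmoothFunOn_const (-1) W) hX hx v
  have h0 : delbar (F := ℂ) (fun _ : M => -1) x v = 0 := delbar_eq_zero mdifferentiableAt_const v
  rw [h0] at h
  simpa using h

variable [FiniteDimensional ℂ E]

theorem IsHolOn.contMDiffAt_coord {X : Field E M} {W : Set M} (hX : IsHolOn X W) (hW : IsOpen W)
    {x y : M} (hy : y ∈ W) (hyx : y ∈ (chartAt E x).source) :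
    ContMDiffAt 𝓘(ℝ, E) 𝓘(ℝ, E) ∞ (coord X x) y :=
  contMDiffAt_of_mdifferentiableOn (hW.inter (chartAt E x).open_source)
    (hX.mdifferentiableOn_coord hW x) ⟨hy, hyx⟩

theorem IsHolOn.isSmoothOn {X : Field E M} {W : Set M} (hX : IsHolOn X W) (hW : IsOpen W) :
    IsSmoothOn X W :=
  fun x hx => hX.contMDiffAt_coord hW hx (mem_chart_source E x)

/-! ### The coordinate frames -/

/-- The coordinate frame of the preferred chart at `x`. -/
def frame (x : M) (i : Fin (Module.finrank ℂ E)) : Field E M :=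
  constField x (Module.finBasis ℂ E i)

/-- The components of a vector field with respect to a coordinate frame. -/
def frameCoeff (X : Field E M) (x : M) (i : Fin (Module.finrank ℂ E)) : M → ℂ := fun y =>
  (Module.finBasis ℂ E).coord i (coord X x y)

theorem isHolOn_frame (x : M) (i : Fin (Module.finrank ℂ E)) :
    IsHolOn (frame x i) (chartAt E x).source :=
  isHolOn_constField x _

theorem eq_sum_frame (X : Field E M) {x y : M} (hy : y ∈ (chartAt E x).source) :
    X y = ∑ i, frameCoeff X x i y • frame x i y := by
  set T := trivializationAt E (TangentSpace 𝓘(ℂ, E) : M → Type _) x with hT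
  have h : ∀ u : E, T.symm y u = T.symmₗ ℂ y u := fun u => by
    rw [Bundle.Trivialization.coe_symmₗ]
    exact hy
  have h1 := trivializationAt_symm_coord X hy
  rw [← hT, h, ← (Module.finBasis ℂ E).sum_repr (coord X x y), map_sum] at h1
  rw [← h1]
  refine Finset.sum_congr rfl fun i _ => ?_
  rw [map_smul, ← h]
  rfl

theorem contMDiffAt_frameCoeff_self {X : Field E M} {y : M}
    (hX : ContMDiffAt 𝓘(ℝ, E) 𝓘(ℝ, E) ∞ (coord X y) y) (i : Fin (Module.finrank ℂ E)) :
    ContMDiffAt 𝓘(ℝ, E) 𝓘(ℝ, ℂ) ∞ (frameCoeff X y i) y := by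
  have hc : ContDiff ℝ ∞ fun u : E => (Module.finBasis ℂ E).coord i u :=
    (LinearMap.toContinuousLinearMap ((Module.finBasis ℂ E).coord i)).contDiff.restrict_scalars ℝ
  exact hc.contMDiff.contMDiffAt.comp y hX

/-- `IsSmoothOn` tests each point only in its own preferred chart. To change charts, the field is
expanded in the frame centred at `y`: the coefficients are smooth at `y` by definition, and the
frame is holomorphic in the chart at `x`. -/
theorem IsSmoothOn.contMDiffAt_coord {X : Field E M} {W : Set M} (hX : IsSmoothOn X W)
    {x y : M} (hy : y ∈ W) (hyx : y ∈ (chartAt E x).source) :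
    ContMDiffAt 𝓘(ℝ, E) 𝓘(ℝ, E) ∞ (coord X x) y := by
  have hsum : ContMDiffAt 𝓘(ℝ, E) 𝓘(ℝ, E) ∞
      (fun z => ∑ i, frameCoeff X y i z • coord (frame y i) x z) y := by
    refine contMDiffAt_finsetSum fun i _ => ?_
    exact contMDiffAt_real_smul (contMDiffAt_frameCoeff_self (hX y hy) i)
      ((isHolOn_frame y i).contMDiffAt_coord (chartAt E y).open_source (mem_chart_source E y) hyx)
  refine hsum.congr_of_eventuallyEq ?_
  filter_upwards [(chartAt E y).open_source.mem_nhds (mem_chart_source E y)] with z hz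
  rw [coord_congr (Y := fun w => ∑ i, frameCoeff X y i w • frame y i w) (eq_sum_frame X hz),
    coord_sum]
  exact Finset.sum_congr rfl fun i _ => coord_smul _ _ _ _

theorem IsSmoothOn.isSmoothFunOn_frameCoeff {X : Field E M} {W : Set M} (hX : IsSmoothOn X W)
    (x : M) (i : Fin (Module.finrank ℂ E)) :
    IsSmoothFunOn (E := E) (frameCoeff X x i) (W ∩ (chartAt E x).source) := by
  rintro y ⟨hy, hyx⟩
  have hc : ContDiff ℝ ∞ fun u : E => (Module.finBasis ℂ E).coord i u :=
    (LinearMap.toContinuousLinearMap ((Module.finBasis ℂ E).coord i)).contDiff.restrict_scalars ℝ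
  exact (hc.contMDiff.contMDiffAt.comp y (hX.contMDiffAt_coord hy hyx)).contMDiffWithinAt

/-- A local additive and `C^∞`-linear operator on smooth vector fields that vanishes on
holomorphic vector fields is zero. -/
theorem eq_zero_of_tensorial {V : Type*} [AddCommGroup V] [Module ℂ V] {x : M}
    (L : Field E M → V)
    (hcongr : ∀ (W : Set M) (X Y : Field E M), IsOpen W → x ∈ W → IsSmoothOn X W →
      IsSmoothOn Y W → (∀ y ∈ W, X y = Y y) → L X = L Y)
    (hadd : ∀ (W : Set M) (X Y : Field E M), IsOpen W → x ∈ W → IsSmoothOn X W →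
      IsSmoothOn Y W → L (fun y => X y + Y y) = L X + L Y)
    (hsmul : ∀ (W : Set M) (f : M → ℂ) (X : Field E M), IsOpen W → x ∈ W →
      IsSmoothFunOn (E := E) f W → IsSmoothOn X W → L (fun y => f y • X y) = f x • L X)
    (hhol : ∀ (W : Set M) (X : Field E M), IsOpen W → x ∈ W → IsHolOn X W → L X = 0)
    {W : Set M} (hW : IsOpen W) (hx : x ∈ W) {X : Field E M} (hX : IsSmoothOn X W) : L X = 0 := by
  classical
  set U := W ∩ (chartAt E x).source
  have hU : IsOpen U := hW.inter (chartAt E x).open_source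
  have hxU : x ∈ U := ⟨hx, mem_chart_source E x⟩
  have hfr : ∀ i, IsHolOn (frame x i) U := fun i => (isHolOn_frame x i).mono inter_subset_right
  have hterm : ∀ i, IsSmoothOn (fun y => frameCoeff X x i y • frame x i y) U := fun i =>
    ((hfr i).isSmoothOn hU).smul hU (hX.isSmoothFunOn_frameCoeff x i)
  have hsum : ∀ s : Finset (Fin (Module.finrank ℂ E)),
      L (fun y => ∑ i ∈ s, frameCoeff X x i y • frame x i y) = 0 := by
    intro s
    induction s using Finset.induction_on with
    | empty =>
      -- Scaling by the zero function gives `L 0 = 0`.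
      have := hsmul univ (fun _ => 0) (fun y => (0 : Tan E y)) isOpen_univ (mem_univ x)
        (isSmoothFunOn_const 0 _) (isSmoothOn_zero _)
      simpa using this
    | insert i s hi ih =>
      simp only [Finset.sum_insert hi]
      rw [hadd U _ _ hU hxU (hterm i) (IsSmoothOn.sum s hterm), ih,
        hsmul U _ _ hU hxU (hX.isSmoothFunOn_frameCoeff x i) ((hfr i).isSmoothOn hU),
        hhol U _ hU hxU (hfr i), smul_zero, add_zero]
  rw [hcongr U X _ hU hxU (hX.mono inter_subset_left) (IsSmoothOn.sum Finset.univ hterm)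
    fun y hy => eq_sum_frame X hy.2]
  exact hsum _

end FieldLemmas

/-! ### Locality and smoothness of connections; passage from holomorphic to smooth fields. -/

section ConnectionLemmas

open Set Filter Topology

variable {E : Type*} [NormedAddCommGroup E] [NormedSpace ℂ E]
  {M : Type*} [TopologicalSpace M] [ChartedSpace E M] [IsManifold 𝓘(ℂ, E) ω M]

/-- The coordinate change from the chart at `y` to the chart at `x` has complex linear derivative,
so it commutes with `i` and preserves the type of the vector. The derivative can thus be computed in
one fixed chart while `y` varies, which makes its smoothness in `y` visible. -/
theorem del_constField {f : M → ℂ} {x y : M} (hy : y ∈ (chartAt E x).source)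
    (hf : ContMDiffAt 𝓘(ℝ, E) 𝓘(ℝ, ℂ) ∞ f y) (u : E) :
    del f y (constField x u y) =
      (1 / 2 : ℂ) • (fderiv ℝ (f ∘ (chartAt E x).symm) (chartAt E x y) u -
        Complex.I • fderiv ℝ (f ∘ (chartAt E x).symm) (chartAt E x y) (Complex.I • u)) := by
  have hyy := mem_chart_source E y
  set φ := chartAt E x with hφ
  set ψ := chartAt E y with hψ
  set T : E →L[ℂ] E := tangentCoordChange 𝓘(ℂ, E) y x y with hT
  have hchange : HasFDerivAt (φ ∘ ψ.symm) T (ψ y) := by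
    have : IsManifold 𝓘(ℂ, E) 1 M := IsManifold.of_le (n := ω) le_top
    have h := hasFDerivWithinAt_tangentCoordChange (I := 𝓘(ℂ, E)) (x := y) (y := x) (z := y)
      (by simpa using hy)
    rw [modelWithCornersSelf_coe, range_id, hasFDerivWithinAt_univ] at h
    exact h
  have hfφ : DifferentiableAt ℝ (f ∘ φ.symm) ((φ ∘ ψ.symm) (ψ y)) := by
    rw [Function.comp_apply, ψ.left_inv hyy]
    exact ((contMDiffAt_real_iff hy).1 hf).differentiableAt (by simp)
  have hcomp : HasFDerivAt ((f ∘ φ.symm) ∘ (φ ∘ ψ.symm))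
      ((fderiv ℝ (f ∘ φ.symm) ((φ ∘ ψ.symm) (ψ y))).comp (T.restrictScalars ℝ)) (ψ y) :=
    hfφ.hasFDerivAt.comp _ (hchange.restrictScalars ℝ)
  have heq : f ∘ ψ.symm =ᶠ[𝓝 (ψ y)] (f ∘ φ.symm) ∘ (φ ∘ ψ.symm) := by
    have hnhds : ψ.target ∩ ψ.symm ⁻¹' φ.source ∈ 𝓝 (ψ y) := by
      refine (ψ.isOpen_inter_preimage_symm φ.open_source).mem_nhds ⟨ψ.map_source hyy, ?_⟩
      rwa [mem_preimage, ψ.left_inv hyy]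
    filter_upwards [hnhds] with z hz
    simp [φ.left_inv hz.2]
  have key : ∀ w : E, T w = u → del f y w = (1 / 2 : ℂ) • (fderiv ℝ (f ∘ φ.symm) (φ y) u -
      Complex.I • fderiv ℝ (f ∘ φ.symm) (φ y) (Complex.I • u)) := by
    intro w hw
    rw [del_eq_chart (hf.mdifferentiableAt (by simp)), heq.fderiv_eq, hcomp.fderiv]
    simp only [ContinuousLinearMap.comp_apply, ContinuousLinearMap.coe_restrictScalars', map_smul,
      hw, Function.comp_apply, ψ.left_inv hyy]
  exact key _ (coord_constField hy u)

theorem isSmoothFunOn_del_constField {f : M → ℂ} {W : Set M} (hW : IsOpen W)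
    (hf : IsSmoothFunOn (E := E) f W) (x : M) (u : E) :
    IsSmoothFunOn (E := E) (fun y => del f y (constField x u y)) (W ∩ (chartAt E x).source) := by
  rintro y ⟨hy, hyx⟩
  refine ContMDiffAt.contMDiffWithinAt ?_
  rw [contMDiffAt_real_iff hyx]
  set φ := chartAt E x with hφ
  have hV : IsOpen (φ.target ∩ φ.symm ⁻¹' W) := φ.isOpen_inter_preimage_symm hW
  have hyV : φ y ∈ φ.target ∩ φ.symm ⁻¹' W :=
    ⟨φ.map_source hyx, by rwa [mem_preimage, φ.left_inv hyx]⟩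
  have hsm : ContDiffOn ℝ ∞ (f ∘ φ.symm) (φ.target ∩ φ.symm ⁻¹' W) := by
    rintro z ⟨hz, hzW⟩
    have h := (contMDiffAt_real_iff (φ.map_target hz)).1 (hf.contMDiffAt hW hzW)
    change ContDiffAt ℝ ∞ (f ∘ φ.symm) (φ (φ.symm z)) at h
    rw [φ.right_inv hz] at h
    exact h.contDiffWithinAt
  have hfd : ContDiffAt ℝ ∞ (fderiv ℝ (f ∘ φ.symm)) (φ y) :=
    ((contDiffOn_infty_iff_fderiv_of_isOpen hV).1 hsm).2.contDiffAt (hV.mem_nhds hyV)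
  have hG : ContDiffAt ℝ ∞ (fun z => (1 / 2 : ℂ) • (fderiv ℝ (f ∘ φ.symm) z u -
      Complex.I • fderiv ℝ (f ∘ φ.symm) z (Complex.I • u))) (φ y) :=
    ((hfd.clm_apply contDiffAt_const).sub
      ((hfd.clm_apply contDiffAt_const).const_smul Complex.I)).const_smul (1 / 2 : ℂ)
  refine hG.congr_of_eventuallyEq ?_
  filter_upwards [hV.mem_nhds hyV] with z hz
  have hzs : φ.symm z ∈ φ.source := φ.map_target hz.1
  rw [Function.comp_apply, del_constField hzs (hf.contMDiffAt hW hz.2), ← hφ, φ.right_inv hz.1]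

/-! ### Smooth connections -/

namespace Connection10

/-- Locality is not an axiom but follows from the Leibniz rule. Smoothness is required on `W` alone,
so the indicator of `W` serves as a cutoff: it has zero derivative on `W`, and its products with `X`
and `Y` agree everywhere. -/
theorem congr_of_eqOn (D : Connection10 E M) {X Y : Field E M} {W : Set M} (hW : IsOpen W)
    (hX : IsSmoothOn X W) (h : ∀ y ∈ W, X y = Y y) {x : M} (hx : x ∈ W) : D X x = D Y x := by
  classical
  have hY : IsSmoothOn Y W := hX.congr hW fun y hy => (h y hy).symm
  set f : M → ℂ := W.indicator fun _ => 1 with hfdef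
  have hf1 : ∀ y ∈ W, f y = 1 := fun y hy => indicator_of_mem hy _
  have hf : IsSmoothFunOn (E := E) f W := (isSmoothFunOn_const 1 W).congr hf1
  have hfX : (fun y => f y • X y) = fun y => f y • Y y := by
    funext y
    by_cases hy : y ∈ W
    · rw [h y hy]
    · simp [hfdef, hy]
  have hdel : ∀ v : Tan E x, del f x v = 0 := fun v => by
    rw [del_congr (g := fun _ => (1 : ℂ)) ?_ v, del_const]
    filter_upwards [hW.mem_nhds hx] with y hy using hf1 y hy
  ext1 v
  have h1 := D.leibniz W f X hW hf hX x hx v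
  have h2 := D.leibniz W f Y hW hf hY x hx v
  rw [hdel, hf1 x hx, one_smul, zero_smul, add_zero] at h1 h2
  rw [← h1, ← h2, hfX]

theorem const_smul (D : Connection10 E M) (c : ℂ) {X : Field E M} {W : Set M} (hW : IsOpen W)
    (hX : IsSmoothOn X W) {x : M} (hx : x ∈ W) : D (fun y => c • X y) x = c • D X x := by
  ext1 v
  have h := D.leibniz W (fun _ => c) X hW (isSmoothFunOn_const c W) hX x hx v
  rw [del_const] at h
  simpa using h

theorem neg (D : Connection10 E M) {X : Field E M} {W : Set M} (hW : IsOpen W)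
    (hX : IsSmoothOn X W) {x : M} (hx : x ∈ W) : D (fun y => -X y) x = -D X x := by
  simpa using D.const_smul (-1) hW hX hx

theorem sum (D : Connection10 E M) {ι : Type*} (s : Finset ι) {X : ι → Field E M} {W : Set M}
    (hW : IsOpen W) (hX : ∀ i, IsSmoothOn (X i) W) {x : M} (hx : x ∈ W) :
    D (fun y => ∑ i ∈ s, X i y) x = ∑ i ∈ s, D (X i) x := by
  classical
  induction s using Finset.induction_on with
  | empty => simpa using D.const_smul 0 hW (isSmoothOn_zero W) hx
  | insert i s hi ih =>
    simp only [Finset.sum_insert hi]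
    rw [D.add W _ _ hW (hX i) (IsSmoothOn.sum s hX) x hx, ih]

/-- Both arguments are expanded in a holomorphic frame; the Leibniz rule leaves frame derivatives,
smooth by hypothesis, and `∂` of the coefficients along coordinate fields. -/
theorem isSmooth_of_hol [FiniteDimensional ℂ E] (D : Connection10 E M)
    (h : ∀ (W : Set M) (X Y : Field E M), IsOpen W → IsHolOn X W → IsHolOn Y W →
      IsSmoothOn (fun x => D Y x (X x)) W) : D.IsSmooth := by
  intro W X Y hW hX hY
  refine isSmoothOn_of_locally fun x hx => ?_
  set U := W ∩ (chartAt E x).source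
  have hU : IsOpen U := hW.inter (chartAt E x).open_source
  have hfr : ∀ i, IsHolOn (frame x i) U := fun i => (isHolOn_frame x i).mono inter_subset_right
  have hYc := hY.isSmoothFunOn_frameCoeff x
  have hXc := hX.isSmoothFunOn_frameCoeff x
  have hterm : ∀ j, IsSmoothOn (fun y => frameCoeff Y x j y • frame x j y) U := fun j =>
    ((hfr j).isSmoothOn hU).smul hU (hYc j)
  refine ⟨U, ⟨hx, mem_chart_source E x⟩, ?_⟩
  have hkey : IsSmoothOn (fun y => ∑ i, frameCoeff X x i y • ∑ j,
      (frameCoeff Y x j y • D (frame x j) y (frame x i y) +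
        del (frameCoeff Y x j) y (frame x i y) • frame x j y)) U := by
    refine IsSmoothOn.sum _ fun i => IsSmoothOn.smul hU (hXc i) (IsSmoothOn.sum _ fun j => ?_)
    refine (IsSmoothOn.smul hU (hYc j) (h U _ _ hU (hfr i) (hfr j))).add ?_
    refine IsSmoothOn.smul hU ?_ ((hfr j).isSmoothOn hU)
    exact (isSmoothFunOn_del_constField hU (hYc j) x _).mono fun y hy => ⟨hy, hy.2⟩
  refine hkey.congr hU fun y hy => ?_
  rw [D.congr_of_eqOn hU (hY.mono inter_subset_left) (fun y hy => eq_sum_frame Y hy.2) hy,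
    D.sum _ hU hterm hy, eq_sum_frame X hy.2, map_sum]
  refine Finset.sum_congr rfl fun i _ => ?_
  rw [map_smul, LinearMap.sum_apply]
  congr 1
  exact Finset.sum_congr rfl fun j _ =>
    D.leibniz U _ _ hU (hYc j) ((hfr j).isSmoothOn hU) y hy _

end Connection10

/-! ### Smooth endomorphisms -/

theorem IsSmoothEnd.add {P Q : EndField E M} (hP : IsSmoothEnd P) (hQ : IsSmoothEnd Q) :
    IsSmoothEnd (fun x => P x + Q x) :=
  fun W X hW hX => (hP W X hW hX).add (hQ W X hW hX)

theorem IsSmoothEnd.commutator {P Q : EndField E M} (hP : IsSmoothEnd P) (hQ : IsSmoothEnd Q) :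
    IsSmoothEnd (fun x => ⁅P x, Q x⁆) := by
  intro W X hW hX
  refine ((hP W _ hW (hQ W X hW hX)).add ((hQ W _ hW (hP W X hW hX)).neg hW)).congr hW fun y _ => ?_
  simp [Ring.lie_def, sub_eq_add_neg]

variable [FiniteDimensional ℂ E]

/-- Locally a smooth field is a combination of a holomorphic frame with smooth coefficients, and `P`
acts on the frame alone. -/
theorem IsHolEnd.isSmoothEnd {P : EndField E M} (hP : IsHolEnd P) : IsSmoothEnd P := by
  intro W X hW hX
  refine isSmoothOn_of_locally fun x hx => ?_
  set U := W ∩ (chartAt E x).source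
  have hU : IsOpen U := hW.inter (chartAt E x).open_source
  have hfr : ∀ i, IsHolOn (frame x i) U := fun i => (isHolOn_frame x i).mono inter_subset_right
  refine ⟨U, ⟨hx, mem_chart_source E x⟩, ?_⟩
  refine (IsSmoothOn.sum Finset.univ fun i => IsSmoothOn.smul hU
    (hX.isSmoothFunOn_frameCoeff x i) ((hP U _ hU (hfr i)).isSmoothOn hU)).congr hU fun y hy => ?_
  rw [eq_sum_frame X hy.2, map_sum]
  exact Finset.sum_congr rfl fun i _ => map_smul _ _ _

theorem IsHolForm.isSmoothOn_apply {Φ : EndForm E M} (hΦ : IsHolForm Φ) {W : Set M} (hW : IsOpen W)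
    {X Z : Field E M} (hX : IsHolOn X W) (hZ : IsSmoothOn Z W) :
    IsSmoothOn (fun x => Φ x (X x) (Z x)) W := by
  refine isSmoothOn_of_locally fun x hx => ?_
  set U := W ∩ (chartAt E x).source
  have hU : IsOpen U := hW.inter (chartAt E x).open_source
  have hfr : ∀ i, IsHolOn (frame x i) U := fun i => (isHolOn_frame x i).mono inter_subset_right
  refine ⟨U, ⟨hx, mem_chart_source E x⟩, ?_⟩
  refine (IsSmoothOn.sum Finset.univ fun i => IsSmoothOn.smul hU (hZ.isSmoothFunOn_frameCoeff x i)
    ((hΦ U _ _ hU (hX.mono inter_subset_left) (hfr i)).isSmoothOn hU)).congr hU fun y hy => ?_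
  rw [eq_sum_frame Z hy.2, map_sum]
  exact Finset.sum_congr rfl fun i _ => map_smul _ _ _

theorem IsHolBilin.isSmoothFunOn_apply {g : BilinField E M} (hg : IsHolBilin g) {W : Set M}
    (hW : IsOpen W) {X Z : Field E M} (hX : IsHolOn X W) (hZ : IsSmoothOn Z W) :
    IsSmoothFunOn (E := E) (fun x => g x (X x) (Z x)) W := by
  intro x hx
  set U := W ∩ (chartAt E x).source
  have hU : IsOpen U := hW.inter (chartAt E x).open_source
  have hxU : x ∈ U := ⟨hx, mem_chart_source E x⟩
  have hfr : ∀ i, IsHolOn (frame x i) U := fun i => (isHolOn_frame x i).mono inter_subset_right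
  have hsum : ContMDiffAt 𝓘(ℝ, E) 𝓘(ℝ, ℂ) ∞
      (fun y => ∑ i, frameCoeff Z x i y • g y (X y) (frame x i y)) x :=
    contMDiffAt_finsetSum fun i _ => contMDiffAt_real_smul
      ((hZ.isSmoothFunOn_frameCoeff x i).contMDiffAt hU hxU) (contMDiffAt_of_mdifferentiableOn hU
        (hg U _ _ hU (hX.mono inter_subset_left) (hfr i)) hxU)
  refine (hsum.congr_of_eventuallyEq ?_).contMDiffWithinAt
  filter_upwards [hU.mem_nhds hxU] with y hy
  rw [eq_sum_frame Z hy.2, map_sum]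
  exact Finset.sum_congr rfl fun i _ => map_smul _ _ _

/-- The derivative of a smooth endomorphism along `(0,1)` vectors is determined by holomorphic
vector fields. -/
theorem dbar_end_of_hol {P : EndField E M} (hP : IsSmoothEnd P) {x : M} {v : Tan E x}
    {S : Module.End ℂ (Tan E x)}
    (h : ∀ (W : Set M) (Z : Field E M), IsOpen W → x ∈ W → IsHolOn Z W →
      dbar (fun y => P y (Z y)) x v = S (Z x))
    {W : Set M} (hW : IsOpen W) (hx : x ∈ W) {Z : Field E M} (hZ : IsSmoothOn Z W) :
    dbar (fun y => P y (Z y)) x v = P x (dbar Z x v) + S (Z x) := by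
  rw [← sub_eq_zero]
  -- The Leibniz terms in the derivative of `f` cancel between the two sides, so their difference is
  -- tensorial in `Z`.
  refine eq_zero_of_tensorial
    (fun Z => dbar (fun y => P y (Z y)) x v - (P x (dbar Z x v) + S (Z x))) ?_ ?_ ?_ ?_ hW hx hZ
  · intro W X Y hW hx _ _ hXY
    rw [dbar_congr hW (fun y hy => by rw [hXY y hy]) hx, dbar_congr hW hXY hx, hXY x hx]
  · intro W X Y hW hx hX hY
    simp only [map_add]
    rw [dbar_add (hP W X hW hX) (hP W Y hW hY) hx, dbar_add hX hY hx, map_add]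
    abel
  · intro W f X hW hx hf hX
    simp only [map_smul]
    rw [dbar_smul hW hf (hP W X hW hX) hx, dbar_smul hW hf hX hx, map_add, map_smul, map_smul]
    module
  · intro W X hW hx hX
    rw [h W X hW hx hX, hX.dbar_eq_zero hW hx]
    simp

theorem IsHolEnd.dbar_apply {P : EndField E M} (hP : IsHolEnd P) {W : Set M} (hW : IsOpen W)
    {x : M} (hx : x ∈ W) {Z : Field E M} (hZ : IsSmoothOn Z W) (v : Tan E x) :
    dbar (fun y => P y (Z y)) x v = P x (dbar Z x v) := by
  have h := dbar_end_of_hol hP.isSmoothEnd (x := x) (v := v) (S := 0)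
    (fun W Z hW hx hZ => by simpa using (hP W Z hW hZ).dbar_eq_zero hW hx v) hW hx hZ
  simpa using h

/-- The covariant derivative of a smooth endomorphism is determined by holomorphic vector
fields. -/
theorem Connection10.covEnd_of_hol (D : Connection10 E M) {P : EndField E M} (hP : IsSmoothEnd P)
    {x : M} {v : Tan E x} {S : Module.End ℂ (Tan E x)}
    (h : ∀ (W : Set M) (Z : Field E M), IsOpen W → x ∈ W → IsHolOn Z W →
      D.covEnd P Z x v = S (Z x))
    {W : Set M} (hW : IsOpen W) (hx : x ∈ W) {Z : Field E M} (hZ : IsSmoothOn Z W) :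
    D.covEnd P Z x v = S (Z x) := by
  rw [← sub_eq_zero]
  refine eq_zero_of_tensorial (fun Z => D.covEnd P Z x v - S (Z x)) ?_ ?_ ?_ ?_ hW hx hZ
  · intro W X Y hW hx hX hY hXY
    simp only [covEnd]
    rw [D.congr_of_eqOn hW (hP W X hW hX) (fun y hy => by rw [hXY y hy]) hx,
      D.congr_of_eqOn hW hX hXY hx, hXY x hx]
  · intro W X Y hW hx hX hY
    simp only [covEnd, map_add]
    rw [D.add W _ _ hW (hP W X hW hX) (hP W Y hW hY) x hx, D.add W _ _ hW hX hY x hx,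
      LinearMap.add_apply, LinearMap.add_apply, map_add]
    abel
  · intro W f X hW hx hf hX
    simp only [covEnd, map_smul]
    rw [D.leibniz W _ _ hW hf (hP W X hW hX) x hx, D.leibniz W _ _ hW hf hX x hx, map_add,
      map_smul, map_smul]
    module
  · intro W X hW hx hX
    rw [h W X hW hx hX, sub_self]

end ConnectionLemmas

/-! ### The underlying Frobenius manifold of charge `2c`. -/

section FrobeniusLemmas

open Set Filter Topology

variable {E : Type*} [NormedAddCommGroup E] [NormedSpace ℂ E]
  {M : Type*} [TopologicalSpace M] [ChartedSpace E M] [IsManifold 𝓘(ℂ, E) ω M]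

namespace FrobeniusManifold

variable (F : FrobeniusManifold E M)

theorem mul_apply (x : M) (a b : Tan E x) : F.mul x a b = -F.Phi x a b := rfl

theorem phi_apply_e (x : M) (a : Tan E x) : F.Phi x a (F.e x) = -a := by
  rw [F.phi_symm, F.phi_e]; simp

theorem phi_comm_apply (x : M) (a b c : Tan E x) :
    F.Phi x a (F.Phi x b c) = F.Phi x b (F.Phi x a c) := by
  simpa [Ring.lie_def, sub_eq_zero] using LinearMap.congr_fun (F.phi_wedge x a b) c

theorem u_phi_apply (x : M) (a b : Tan E x) : F.U x (F.Phi x a b) = F.Phi x a (F.U x b) := by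
  simpa [Ring.lie_def, sub_eq_zero] using LinearMap.congr_fun (F.u_phi x a) b

/-- `U b = -U Φ_b e = -Φ_b U e = -Φ_{U e} b`, by the unit property, `[U, Φ] = 0` and the symmetry of
`Φ`. -/
theorem mul_euler (x : M) : F.mul x (F.euler x) = F.U x := by
  ext b
  rw [mul_apply, F.phi_symm, euler, ← u_phi_apply, phi_apply_e, map_neg, neg_neg]

theorem phi_euler (x : M) (a : Tan E x) : F.Phi x (F.euler x) a = -F.U x a := by
  rw [← F.mul_euler, mul_apply, neg_neg]

theorem euler_hol : IsHolOn F.euler univ := F.u_hol univ F.e isOpen_univ F.e_hol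

/-- This is the Saito equation for `∇U` evaluated at the flat field `e`: there `Φ_v e = -v` and `V e
= c e`, so `[Φ_v, V] e = V v - c v`. -/
theorem nabla_euler (x : M) (v : Tan E x) :
    F.nabla F.euler x v = (1 - F.c) • v + F.V x v := by
  have h := F.nabla_u univ F.e isOpen_univ F.e_hol x (mem_univ x) v
  simp only [Connection10.covEnd, F.nabla_e, Ring.lie_def, LinearMap.sub_apply,
    Module.End.mul_apply, F.v_e, map_smul, F.phi_apply_e, map_neg, LinearMap.zero_apply,
    map_zero] at h
  change F.nabla F.euler x v - _ - _ + _ = _ at h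
  linear_combination (norm := module) h

variable [FiniteDimensional ℂ E]

theorem nabla_mul {W : Set M} {X Y : Field E M} (hW : IsOpen W) (hX : IsHolOn X W)
    (hY : IsHolOn Y W) {x : M} (hx : x ∈ W) :
    F.nabla (fun y => F.mul y (X y) (Y y)) x = -F.nabla (fun y => F.Phi y (X y) (Y y)) x :=
  F.nabla.neg hW ((F.phi_hol W X Y hW hX hY).isSmoothOn hW) hx

theorem potential {W : Set M} {X Y Z : Field E M} (hW : IsOpen W) (hX : IsHolOn X W)
    (hY : IsHolOn Y W) (hZ : IsHolOn Z W) {x : M} (hx : x ∈ W) :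
    F.nabla (fun y => F.mul y (Y y) (Z y)) x (X x) - F.mul x (F.nabla Y x (X x)) (Z x)
        - F.mul x (Y x) (F.nabla Z x (X x)) =
      F.nabla (fun y => F.mul y (X y) (Z y)) x (Y x) - F.mul x (F.nabla X x (Y x)) (Z x)
        - F.mul x (X x) (F.nabla Z x (Y x)) := by
  have h := F.nabla_phi W X Y Z hW hX hY hZ x hx
  rw [← F.torsion_free W X Y hW hX hY x hx] at h
  simp only [Connection10.covEnd, map_sub, LinearMap.sub_apply] at h
  rw [F.nabla_mul hW hY hZ hx, F.nabla_mul hW hX hZ hx]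
  simp only [mul_apply, LinearMap.neg_apply]
  linear_combination (norm := module) -h

/-- Potentiality exchanges `(∇_E ∘)(X, Y)` for `(∇_X ∘)(E, Y)`. As `E ∘ Y = U Y`, the latter is
given by the equation for `∇U`, and its `V`-terms cancel those of `∇E`. -/
theorem lie_euler_mul {W : Set M} {X Y : Field E M} (hW : IsOpen W) (hX : IsHolOn X W)
    (hY : IsHolOn Y W) {x : M} (hx : x ∈ W) :
    bracket F.euler (fun y => F.mul y (X y) (Y y)) x - F.mul x (bracket F.euler X x) (Y x)
      - F.mul x (X x) (bracket F.euler Y x) = F.mul x (X x) (Y x) := by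
  have hE : IsHolOn F.euler W := F.euler_hol.mono (subset_univ W)
  have hXY : IsHolOn (fun y => F.mul y (X y) (Y y)) W := (F.phi_hol W X Y hW hX hY).neg hW
  have hpot := F.potential hW hE hX hY hx
  have hU := F.nabla_u W Y hW hY x hx (X x)
  have hEY : (fun y => F.mul y (F.euler y) (Y y)) = fun y => F.U y (Y y) := by
    funext y; rw [F.mul_euler]
  rw [hEY, F.mul_euler, nabla_euler] at hpot
  simp only [Connection10.covEnd, Ring.lie_def, LinearMap.sub_apply, Module.End.mul_apply] at hU
  rw [← F.torsion_free W _ _ hW hE hX x hx, ← F.torsion_free W _ _ hW hE hY x hx,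
    ← F.torsion_free W _ _ hW hE hXY x hx]
  simp only [nabla_euler, map_sub, map_add, map_smul, LinearMap.sub_apply, LinearMap.add_apply,
    LinearMap.smul_apply, mul_apply, map_neg] at hpot hU ⊢
  linear_combination (norm := module) hpot + hU

omit [FiniteDimensional ℂ E] in
theorem lie_euler_g {W : Set M} {X Y : Field E M} (hW : IsOpen W) (hX : IsHolOn X W)
    (hY : IsHolOn Y W) {x : M} (hx : x ∈ W) :
    del (fun y => F.g y (X y) (Y y)) x (F.euler x) - F.g x (bracket F.euler X x) (Y x)
      - F.g x (X x) (bracket F.euler Y x) = (2 - 2 * F.c) * F.g x (X x) (Y x) := by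
  have hE : IsHolOn F.euler W := F.euler_hol.mono (subset_univ W)
  rw [← F.torsion_free W _ _ hW hE hX x hx, ← F.torsion_free W _ _ hW hE hY x hx,
    F.nabla_g W X Y hW hX hY x hx]
  simp only [nabla_euler, map_sub, map_add, map_smul, LinearMap.sub_apply, LinearMap.add_apply,
    LinearMap.smul_apply, smul_eq_mul]
  linear_combination F.v_adj x (X x) (Y x)

theorem isFrobenius : IsFrobenius F.nabla F.mul F.e F.euler F.g (2 * F.c) where
  mul_hol W X Y hW hX hY := (F.phi_hol W X Y hW hX hY).neg hW
  mul_comm x a b := by rw [mul_apply, mul_apply, F.phi_symm]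
  mul_assoc x a b c := by
    simp only [mul_apply, map_neg, LinearMap.neg_apply, neg_neg]
    -- Associativity is the commutation of the operators `Φ_a` and `Φ_c`, read through the symmetry
    -- of `Φ`.
    rw [F.phi_symm x _ c, F.phi_comm_apply, F.phi_symm x c b]
  e_hol := F.e_hol
  one_mul x a := by rw [mul_apply, F.phi_e]; simp
  euler_hol := F.euler_hol
  g_hol := F.g_hol
  g_symm := F.g_symm
  g_nondeg := F.g_nondeg
  g_mul x a b c := by
    rw [mul_apply, mul_apply, F.phi_symm, map_neg, map_neg, LinearMap.neg_apply, F.phi_adj]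
  nabla_hol := F.nabla_hol
  torsion_free := F.torsion_free
  nabla_g := F.nabla_g
  flat := F.nabla_sq
  nabla_e := F.nabla_e
  potential W X Y Z hW hX hY hZ x hx := F.potential hW hX hY hZ hx
  lie_mul W X Y hW hX hY x hx := F.lie_euler_mul hW hX hY hx
  lie_g W X Y hW hX hY x hx := F.lie_euler_g hW hX hY hx

end FrobeniusManifold

end FrobeniusLemmas

/-! ### The real structure, the endomorphism `Q`, and the CDV axioms. -/

section HarmonicLemmas

open Set Filter Topology

variable {E : Type*} [NormedAddCommGroup E] [NormedSpace ℂ E]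
  {M : Type*} [TopologicalSpace M] [ChartedSpace E M] [IsManifold 𝓘(ℂ, E) ω M]

namespace HarmonicFrobeniusManifold

variable (F : HarmonicFrobeniusManifold E M)

theorem h_apply (x : M) (a b : Tan E x) : F.h x a b = F.g x a (F.kappa x b) := rfl

theorem conjEnd_apply (x : M) (P : Module.End ℂ (Tan E x)) (a : Tan E x) :
    conjEnd F.kappa x P a = F.kappa x (P (F.kappa x a)) := rfl

theorem g_ext {x : M} {b b' : Tan E x} (h : ∀ a, F.g x a b = F.g x a b') : b = b' := by
  rw [← sub_eq_zero]
  refine F.g_nondeg x _ fun a => ?_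
  rw [F.g_symm, map_sub, h, sub_self]

theorem g_kappa (x : M) (a b : Tan E x) :
    F.g x (F.kappa x a) (F.kappa x b) = starRingEnd ℂ (F.g x a b) := by
  have hdec : ∀ c : Tan E x, ∃ c₁ c₂ : Tan E x, F.kappa x c₁ = c₁ ∧ F.kappa x c₂ = c₂ ∧
      c = c₁ + Complex.I • c₂ := by
    intro c
    -- The real and imaginary parts of `c` with respect to `κ`. Reality of `g` on such parts
    -- determines its behaviour on all vectors.
    refine ⟨(1 / 2 : ℂ) • (c + F.kappa x c), (-Complex.I / 2) • (c - F.kappa x c), ?_, ?_, ?_⟩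
    · simp only [map_smulₛₗ, map_add, F.kappa_sq, map_div₀, map_one, map_ofNat]
      module
    · simp only [map_smulₛₗ, map_sub, F.kappa_sq, map_div₀, map_neg, Complex.conj_I, map_ofNat]
      module
    · rw [smul_smul, mul_div_assoc', mul_neg, Complex.I_mul_I]
      module
  obtain ⟨a₁, a₂, ha₁, ha₂, rfl⟩ := hdec a
  obtain ⟨b₁, b₂, hb₁, hb₂, rfl⟩ := hdec b
  have hreal : ∀ u v, F.kappa x u = u → F.kappa x v = v →
      starRingEnd ℂ (F.g x u v) = F.g x u v := fun u v hu hv =>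
    Complex.conj_eq_iff_im.2 (F.g_real x u v hu hv)
  simp only [map_add, map_smulₛₗ, ha₁, ha₂, hb₁, hb₂, LinearMap.add_apply, LinearMap.smul_apply,
    smul_eq_mul, Complex.conj_I, map_mul, hreal _ _ ha₁ hb₁, hreal _ _ ha₁ hb₂,
    hreal _ _ ha₂ hb₁, hreal _ _ ha₂ hb₂, RingHom.id_apply]

theorem h_hermitian (x : M) (a b : Tan E x) : F.h x b a = starRingEnd ℂ (F.h x a b) := by
  rw [h_apply, h_apply, ← g_kappa, F.kappa_sq, F.g_symm]

/-- Moving the `g`-selfadjoint `Φ_v` across `h(a, b) = g(a, κ b)` puts it in front of `κ b`;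
nondegeneracy then gives `κ Φ†_v = Φ_v κ`. -/
theorem phiDag_eq_conjEnd (x : M) (v : Tan E x) :
    F.PhiDag x v = conjEnd F.kappa x (F.Phi x v) := by
  ext b
  have h : F.kappa x (F.PhiDag x v b) = F.Phi x v (F.kappa x b) := by
    refine F.g_ext fun a => ?_
    have h := F.phi_dagger x v a b
    rw [h_apply, h_apply, F.phi_adj] at h
    exact h.symm
  rw [conjEnd_apply, ← h, F.kappa_sq]

theorem Q_apply (x : M) (a : Tan E x) :
    F.Q x a = F.V x a + (F.Adag x (F.U x a) - F.U x (F.Adag x a)) := rfl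

/-- `Q` is `g`-skew, since `V` is and the commutator of the `g`-selfadjoint `A†` and `U` is. It is
also `h`-selfadjoint, and `h` differs from `g` by `κ`, which accounts for the sign. -/
theorem Q_kappa (x : M) (a : Tan E x) : F.Q x (F.kappa x a) = -F.kappa x (F.Q x a) := by
  have hQ : ∀ u v, F.g x (F.Q x u) v = -F.g x u (F.Q x v) := fun u v => by
    simp only [Q_apply, map_add, map_sub, LinearMap.add_apply, LinearMap.sub_apply, F.adag_adj,
      F.u_adj]
    linear_combination F.v_adj x u v
  refine F.g_ext fun u => ?_
  have h := F.q_dagger x u a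
  rw [h_apply, h_apply, hQ] at h
  rw [map_neg, ← h, neg_neg]

theorem D_apply (X : Field E M) (x : M) (v : Tan E x) :
    F.D X x v = F.nabla X x v - (F.Adag x (F.Phi x v (X x)) - F.Phi x v (F.Adag x (X x))) :=
  F.toPotentialRealData.D_apply X x v

/-- Torsion-freeness gives `∇_E X = [E, X] + ∇_X E`, contributing `(1 - c) X + V X`. As `Φ_E = -U`,
the correction `-[A†, Φ_E]` is `[A†, U]`, which completes `V` to `Q`. -/
theorem D_euler {W : Set M} {X : Field E M} (hW : IsOpen W) (hX : IsHolOn X W) {x : M}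
    (hx : x ∈ W) :
    F.D X x (F.euler x) = bracket F.euler X x + (1 - F.c) • X x + F.Q x (X x) := by
  rw [D_apply, ← F.torsion_free W _ _ hW (F.euler_hol.mono (subset_univ W)) hX x hx,
    F.nabla_euler, F.phi_euler, F.phi_euler, Q_apply, map_neg]
  module

/-- `Φ_e = -id` commutes with `A†`, and `e` is flat, so both corrections to the bracket vanish. -/
theorem D_e {W : Set M} {X : Field E M} (hW : IsOpen W) (hX : IsHolOn X W) {x : M}
    (hx : x ∈ W) : F.D X x (F.e x) = bracket F.e X x := by
  rw [D_apply, ← F.torsion_free W _ _ hW (F.e_hol.mono (subset_univ W)) hX x hx,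
    F.nabla_e, F.phi_e]
  simp

variable [FiniteDimensional ℂ E]

/-- The derivative of `g(Y, κ Z)` is expanded both by the Chern property of `h` and by `D'(g) = 0`.
The terms in `D' Y` agree, and nondegeneracy identifies the others. The second relation is the first
applied to `κ Z`. -/
theorem D_kappa : F.D.KillsReal F.kappa := by
  have h1 : ∀ (W : Set M) (Z : Field E M), IsOpen W → IsSmoothOn Z W → ∀ x ∈ W, ∀ v : Tan E x,
      F.D (fun y => F.kappa y (Z y)) x v = F.kappa x (dbar Z x v) := by
    intro W Z hW hZ x hx v
    refine F.g_ext fun a => ?_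
    set U := W ∩ (chartAt E x).source
    have hU : IsOpen U := hW.inter (chartAt E x).open_source
    have hxU : x ∈ U := ⟨hx, mem_chart_source E x⟩
    obtain ⟨Y, hYhol, rfl⟩ := exists_isHolOn_eq x a
    have hY : IsSmoothOn Y U := (hYhol.mono inter_subset_right).isSmoothOn hU
    have hZU : IsSmoothOn Z U := hZ.mono inter_subset_left
    have hc := F.d_chern U Y Z hU hY hZU x hxU v
    have hg := F.d_g U _ _ hU hY (F.kappa_smooth U Z hU hZU) x hxU v
    simp only [h_apply] at hc
    rw [hg, add_right_inj] at hc
    exact hc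
  intro W Z hW hZ x hx v
  refine ⟨h1 W Z hW hZ x hx v, ?_⟩
  have h2 := h1 W _ hW (F.kappa_smooth W Z hW hZ) x hx v
  simp only [F.kappa_sq] at h2
  rw [h2, F.kappa_sq]

theorem Q_smooth : IsSmoothEnd F.Q :=
  F.v_hol.isSmoothEnd.add (F.adag_smooth.commutator F.u_hol.isSmoothEnd)

theorem D_smooth : F.D.IsSmooth := by
  refine F.D.isSmooth_of_hol fun W X Y hW hX hY => ?_
  have hAP := F.adag_smooth W _ hW ((F.phi_hol W X Y hW hX hY).isSmoothOn hW)
  have hPA := F.phi_hol.isSmoothOn_apply hW hX (F.adag_smooth W _ hW (hY.isSmoothOn hW))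
  refine ((((F.nabla_hol W X Y hW hX hY).isSmoothOn hW).add (hAP.neg hW)).add hPA).congr hW
    fun y _ => ?_
  rw [D_apply]
  abel

theorem lie_e_h : LieKills F.e F.h := by
  intro W X Y hW hX hY x hx
  rw [F.d_chern W X Y hW (hX.isSmoothOn hW) (hY.isSmoothOn hW) x hx,
    hY.dbar_eq_zero hW hx, F.D_e hW hX hx]
  simp [h_apply]

theorem del_h_euler {W : Set M} {X Y : Field E M} (hW : IsOpen W) (hX : IsHolOn X W)
    (hY : IsHolOn Y W) {x : M} (hx : x ∈ W) :
    del (fun y => F.h y (X y) (Y y)) x (F.euler x) = F.h x (bracket F.euler X x) (Y x) +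
      (1 - F.c) * F.h x (X x) (Y x) + F.h x (F.Q x (X x)) (Y x) := by
  rw [F.d_chern W X Y hW (hX.isSmoothOn hW) (hY.isSmoothOn hW) x hx,
    hY.dbar_eq_zero hW hx, F.D_euler hW hX hx]
  simp [h_apply]

/-- By Hermitian symmetry the `Ē`-derivative is the conjugate of the `E`-derivative with `X` and `Y`
exchanged. In the difference the terms `1 - c` cancel because `c` is real, and the `Q`-terms because
`Q` is `h`-selfadjoint. -/
theorem lie_euler_h : LieSubConjKills F.euler F.h := by
  intro W X Y hW hX hY x hx
  have hsm : IsSmoothFunOn (E := E) (fun y => F.h y (Y y) (X y)) W :=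
    F.g_hol.isSmoothFunOn_apply hW hY (F.kappa_smooth W X hW (hX.isSmoothOn hW))
  have hconj : delbar (fun y => F.h y (X y) (Y y)) x (F.euler x) =
      starRingEnd ℂ (del (fun y => F.h y (Y y) (X y)) x (F.euler x)) := by
    rw [← delbar_conj ((hsm.contMDiffAt hW hx).mdifferentiableAt (by simp))]
    simp only [← h_hermitian]
  have hc : starRingEnd ℂ F.c = F.c := Complex.conj_eq_iff_im.2 F.c_real
  rw [hconj, F.del_h_euler hW hX hY hx, F.del_h_euler hW hY hX hx]
  simp only [map_add, map_mul, map_sub, map_one, hc, ← h_hermitian]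
  linear_combination F.q_dagger x (X x) (Y x)

/-! ### The integrability equations -/

-- Because `U` commutes with `Φ_v`, the Jacobi identity gives `-[[A†, Φ_v], U] = [Φ_v, [A†, U]]`.
-- Passing from `∇` to `D'` therefore replaces `V` by `Q` in the Saito equation.
omit [FiniteDimensional ℂ E] in
theorem D_cov_U {W : Set M} {Z : Field E M} (hW : IsOpen W) (hZ : IsHolOn Z W) {x : M}
    (hx : x ∈ W) (v : Tan E x) :
    F.D.covEnd F.U Z x v = (⁅F.Phi x v, F.Q x⁆ - F.Phi x v) (Z x) := by
  have h := F.nabla_u W Z hW hZ x hx v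
  have hUP : ∀ a, F.U x (F.Phi x v a) = F.Phi x v (F.U x a) := F.u_phi_apply x v
  simp only [Connection10.covEnd, D_apply, Ring.lie_def, LinearMap.sub_apply,
    Module.End.mul_apply, Q_apply, map_add, map_sub] at h ⊢
  rw [hUP, hUP]
  linear_combination (norm := module) h

/-- Needed for fields of the form `κ Z`, which are only smooth even when `Z` is holomorphic. -/
theorem D_cov_U_smooth {W : Set M} {Z : Field E M} (hW : IsOpen W) (hZ : IsSmoothOn Z W) {x : M}
    (hx : x ∈ W) (v : Tan E x) :
    F.D.covEnd F.U Z x v = (⁅F.Phi x v, F.Q x⁆ - F.Phi x v) (Z x) :=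
  F.D.covEnd_of_hol F.u_hol.isSmoothEnd (fun _ _ hW hx hZ => F.D_cov_U hW hZ hx v) hW hx hZ

/-- `U` and `V` are holomorphic, so only `A†` is differentiated, and `d''A† = Φ†`. -/
theorem dbar_Q {W : Set M} {Z : Field E M} (hW : IsOpen W) (hZ : IsSmoothOn Z W) {x : M}
    (hx : x ∈ W) (v : Tan E x) :
    dbar (fun y => F.Q y (Z y)) x v = F.Q x (dbar Z x v) + ⁅F.PhiDag x v, F.U x⁆ (Z x) := by
  refine dbar_end_of_hol F.Q_smooth (fun W Z hW hx hZ => ?_) hW hx hZ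
  have hUZ := F.u_hol W Z hW hZ
  have hAZ := F.adag_smooth W Z hW (hZ.isSmoothOn hW)
  have hVZ := F.v_hol W Z hW hZ
  have hAUZ := F.adag_smooth W _ hW (hUZ.isSmoothOn hW)
  have hUAZ := F.u_hol.isSmoothEnd W _ hW hAZ
  have hQ : (fun y => F.Q y (Z y)) = fun y => F.V y (Z y) +
      (F.Adag y (F.U y (Z y)) + -F.U y (F.Adag y (Z y))) := by
    funext y
    rw [Q_apply, sub_eq_add_neg]
  rw [hQ, dbar_add (hVZ.isSmoothOn hW) (hAUZ.add (hUAZ.neg hW)) hx,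
    dbar_add hAUZ (hUAZ.neg hW) hx, dbar_neg hW hUAZ hx, hVZ.dbar_eq_zero hW hx,
    F.u_hol.dbar_apply hW hx hAZ, ← F.phiDag_eq W _ hW hUZ x hx,
    ← F.phiDag_eq W _ hW hZ x hx, zero_add, ← sub_eq_add_neg]
  rfl

theorem isIntegrable : IsIntegrable F.D F.Phi (fun x v => conjEnd F.kappa x (F.Phi x v)) F.U
    (fun x => conjEnd F.kappa x (F.U x)) F.Q where
  u_hol := F.u_hol
  phi_u x v := by
    ext a
    simp [Ring.lie_def, F.u_phi_apply]
  d_u W Z hW hZ x hx v := by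
    rw [F.D_cov_U hW hZ hx, LinearMap.sub_apply]
    abel
  d_q W Z hW hZ x hx v := by
    have hκZ := F.kappa_smooth W Z hW (hZ.isSmoothOn hW)
    have hQκZ := F.Q_smooth W _ hW hκZ
    -- Writing `Q = -κQκ` turns `D'(Q)` into the `κ`-conjugate of `d''(Q)`.
    have hQ : (fun y => F.Q y (Z y)) = fun y => -F.kappa y (F.Q y (F.kappa y (Z y))) := by
      funext y
      rw [← Q_kappa, F.kappa_sq]
    simp only [Connection10.covEnd]
    rw [hQ, F.D.neg hW (F.kappa_smooth W _ hW hQκZ) hx, LinearMap.neg_apply,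
      (F.D_kappa W _ hW hQκZ x hx v).1, F.dbar_Q hW hκZ hx,
      (F.D_kappa W Z hW (hZ.isSmoothOn hW) x hx v).2, map_add, Q_kappa, map_neg, F.kappa_sq,
      phiDag_eq_conjEnd]
    simp only [Ring.lie_def, LinearMap.sub_apply, Module.End.mul_apply, conjEnd_apply,
      F.kappa_sq, map_sub]
    abel
  d_uDag W Z hW hZ x hx v := by
    have hκZ := F.kappa_smooth W Z hW (hZ.isSmoothOn hW)
    simp only [Connection10.covEnd, conjEnd_apply]
    -- The conjugate of the holomorphy of `U`.
    rw [(F.D_kappa W _ hW (F.u_hol.isSmoothEnd W _ hW hκZ) x hx v).1,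
      F.u_hol.dbar_apply hW hx hκZ, (F.D_kappa W Z hW (hZ.isSmoothOn hW) x hx v).2, sub_self]
  phiDag_uDag x v := by
    ext a
    simp only [Ring.lie_def, LinearMap.sub_apply, Module.End.mul_apply, conjEnd_apply,
      F.kappa_sq, F.u_phi_apply, sub_self, LinearMap.zero_apply]
  dbar_uDag W Z hW hZ x hx v := by
    have hκZ := F.kappa_smooth W Z hW (hZ.isSmoothOn hW)
    -- The conjugate of the equation for `D'(U)`, applied to `κ Z`; the term `U D' κ Z = U κ d'' Z`
    -- vanishes as `Z` is holomorphic.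
    have hU := F.D_cov_U_smooth hW hκZ hx v
    rw [Connection10.covEnd, sub_eq_iff_eq_add,
      (F.D_kappa W Z hW (hZ.isSmoothOn hW) x hx v).1, hZ.dbar_eq_zero hW hx] at hU
    simp only [conjEnd_apply]
    rw [(F.D_kappa W _ hW (F.u_hol.isSmoothEnd W _ hW hκZ) x hx v).2, hU]
    simp only [Ring.lie_def, LinearMap.sub_apply, Module.End.mul_apply, conjEnd_apply,
      map_sub, map_add, map_zero, Q_kappa, map_neg]
    abel
  dbar_q W Z hW hZ x hx v := by
    rw [F.dbar_Q hW (hZ.isSmoothOn hW) hx, hZ.dbar_eq_zero hW hx, map_zero, zero_add,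
      phiDag_eq_conjEnd, sub_self]

theorem isCDV :
    IsCDV F.nabla F.mul F.e F.euler F.g (2 * F.c) F.kappa F.D F.Q := by
  have hC : (fun x => -F.mul x) = F.Phi := funext fun x => neg_neg (F.Phi x)
  have hCx : ∀ x, -F.mul x = F.Phi x := fun x => neg_neg (F.Phi x)
  have hCdag : (fun x v => conjEnd F.kappa x ((-F.mul x) v)) = F.PhiDag := by
    funext x v
    rw [hCx, phiDag_eq_conjEnd]
  refine
    { frobenius := F.isFrobenius
      d_real := by simp [Complex.mul_im, F.c_real]
      kappa_smooth := F.kappa_smooth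
      kappa_sq := F.kappa_sq
      h_hermitian := F.h_hermitian
      h_nondeg := fun x a ha => F.g_nondeg x a fun b => by
        simpa [herm, F.kappa_sq] using ha (F.kappa x b)
      h_real := fun x a b => F.g_kappa x a (F.kappa x b)
      D_smooth := F.D_smooth
      chern := F.d_chern
      D_g := F.d_g
      D_kappa := F.D_kappa
      higgs_adj := fun x v a b => ?_
      harmonic := ?_
      lie_e_h := F.lie_e_h
      lie_euler_h := F.lie_euler_h
      Q_smooth := F.Q_smooth
      Q_eq := fun W X hW hX x hx => ?_
      Q_adj := F.q_dagger
      Q_kappa := F.Q_kappa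
      integrable := ?_ }
  · rw [hCx, ← phiDag_eq_conjEnd]
    exact F.phi_dagger x v a b
  · rw [hC, hCdag]
    exact F.harmonic
  · rw [F.D_euler hW hX hx]
    module
  · simp only [hCx, F.mul_euler]
    exact F.isIntegrable

omit [FiniteDimensional ℂ E] in
theorem eqCovSubLie : EqCovSubLie F.Q F.D F.euler (1 - F.c) := by
  intro W X hW hX x hx
  rw [F.D_euler hW hX hx]
  module

end HarmonicFrobeniusManifold

end HarmonicLemmas

end HarmonicFrobenius

end

theorem mainTheorem5 {E : Type*} [NormedAddCommGroup E] [NormedSpace ℂ E] [FiniteDimensional ℂ E]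
    {M : Type*} [TopologicalSpace M] [ChartedSpace E M] [IsManifold 𝓘(ℂ, E) ω M]
    (F : HarmonicFrobenius.HarmonicFrobeniusManifold E M) :
    HarmonicFrobenius.IsCDV F.nabla F.mul F.e F.euler F.g (2 * F.c) F.kappa F.D F.Q ∧
      HarmonicFrobenius.EqCovSubLie F.Q F.D F.euler (1 - F.c) ∧
      HarmonicFrobenius.LieKills F.e F.h ∧
      HarmonicFrobenius.LieSubConjKills F.euler F.h :=
  ⟨F.isCDV, F.eqCovSubLie, F.lie_e_h, F.lie_euler_h⟩
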